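/- Let $\Gamma=\mathrm{PSL}(2,\mathbb Z)$ act on the upper half plane $\mathbb H$ by Möbius transformations, and let $\iota: z\mapsto -\frac1z$ and $\gamma_0: z\mapsto -\frac1{z+1}$, so that $\Gamma\cong\Gamma_3=\langle \iota,\gamma_0\mid \iota^2=\gamma_0^3=1\rangle$. For $g\in\Gamma$ let the word length of $g$ be the least length of a word in the letters $\iota,\gamma_0,\gamma_0^{-1}$ representing $g$. A closed geodesic of length $\ell>0$ on the orbifold $\mathbb H/\Gamma$ is given by a complete unit-speed geodesic line $c:\mathbb R\to\mathbb H$ together with an element $g\in\Gamma$, its lift, such that $g\cdot c(t)=c(t+\ell)$ for all $t\in\mathbb R$; two such data define the same closed geodesic if their lengths $\ell$ agree and their lines agree up to an element of $\Gamma$ and a change of parameter $t\mapsto \pm t+s$. A closed geodesic is called reciprocal if it passes through a cone point of even order (that is, some $c(t)$ has a stabilizer of even order in $\Gamma$), and primitive if its lift $g$ is a primitive element of $\Gamma$, i.e. $g=b^k$ with $b\in\Gamma$, $k\in\mathbb Z$ only if $k=\pm1$. For a closed geodesic $\gamma$, let $|\gamma|$ be the minimal word length in the conjugacy class of a lift of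 $\gamma$. Then for every real $t$ the number $$N(t)=\bigl|\{\gamma \text{ a primitive reciprocal geodesic with } |\gamma|\le 2t\}\bigr|$$ is finite, and $$N(t)\sim 2^{\lfloor t/2\rfloor},\qquad\text{i.e.}\qquad \lim_{t\to\infty}\frac{N(t)}{2^{\lfloor t/2\rfloor}}=1 .$$ -/

import Mathlib

open Filter Topology
open scoped MatrixGroups UpperHalfPlane

namespace ModularOrbifold

/-- The modular group `PSL(2, ℤ)`. -/
abbrev Modular : Type := PSL(2, ℤ)

lemma center_smul (A : SL(2, ℤ)) (hA : A ∈ Subgroup.center SL(2, ℤ)) (z : ℍ) : A • z = z := by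
  obtain ⟨r, hr, h⟩ := Matrix.SpecialLinearGroup.mem_center_iff.mp hA
  have hr' : r = 1 ∨ r = -1 := by simpa using hr
  rcases hr' with rfl | rfl
  · have : A = 1 := Subtype.ext (by rw [← h]; simp)
    rw [this, one_smul]
  · have : A = -1 := Subtype.ext (by rw [← h]; simp)
    rw [this, ModularGroup.SL_neg_smul, one_smul]

/-- The homomorphism `PSL(2, ℤ) → Perm ℍ` induced by Möbius transformations. -/
noncomputable def actionHom : Modular →* Equiv.Perm ℍ :=
  QuotientGroup.lift (Subgroup.center SL(2, ℤ)) (MulAction.toPermHom SL(2, ℤ) ℍ)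
    (fun A hA => Equiv.ext fun z => center_smul A hA z)

/-- The action of `PSL(2, ℤ)` on the upper half plane by Möbius transformations. -/
noncomputable instance : MulAction Modular ℍ := MulAction.compHom ℍ actionHom

lemma mk_smul (A : SL(2, ℤ)) (z : ℍ) : (QuotientGroup.mk A : Modular) • z = A • z := rfl

/-! ### Word length with respect to the presentation `⟨ι, γ ∣ ι² = γ³ = 1⟩` -/

/-- The involution `ι : z ↦ -1/z`. -/
def iota : Modular := QuotientGroup.mk ModularGroup.S

/-- The translation `α : z ↦ z + 1` (`λ₃ = 2 cos(π/3) = 1`). -/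
def alpha : Modular := QuotientGroup.mk ModularGroup.T

/-- The element `γ = ι α : z ↦ -1/(z + 1)` of order three. -/
def gamma : Modular := iota * alpha

/-- The word length of `g`: the least number of letters `ι, γ, γ⁻¹` in a word representing `g`
(the letter `ι` is its own inverse). -/
noncomputable def wordLength (g : Modular) : ℕ :=
  sInf {n : ℕ | ∃ w : List Modular,
    (∀ x ∈ w, x = iota ∨ x = gamma ∨ x = gamma⁻¹) ∧ w.prod = g ∧ w.length = n}

/-- The minimal word length in the conjugacy class of `g`. -/
noncomputable def classLength (g : Modular) : ℕ :=
  sInf {n : ℕ | ∃ h : Modular, IsConj g h ∧ wordLength h = n}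

/-- `g` is primitive if it is not a proper power: it can be written as `b ^ k` only for
`k = ±1`. -/
def IsPrimitiveElement (g : Modular) : Prop :=
  ∀ (b : Modular) (k : ℤ), g = b ^ k → k = 1 ∨ k = -1

/-! ### Closed geodesics of the modular orbifold `ℍ / PSL(2, ℤ)` -/

/-- The unit-speed parametrization `t ↦ i eᵗ` of the imaginary axis. -/
noncomputable def verticalGeodesic (t : ℝ) : ℍ :=
  UpperHalfPlane.mk ⟨0, Real.exp t⟩ (Real.exp_pos t)

/-- A complete unit-speed geodesic line of the hyperbolic plane: the image of the imaginary axis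
under an orientation preserving isometry. -/
def IsGeodesicLine (c : ℝ → ℍ) : Prop :=
  ∃ A : SL(2, ℝ), ∀ t : ℝ, c t = A • verticalGeodesic t

/-- A parametrized closed geodesic of `ℍ / PSL(2, ℤ)` of length `period`: a geodesic line `line` of
`ℍ`, together with the element `lift` of `PSL(2, ℤ)` which identifies `line t` with
`line (t + period)`. The element `lift` is the lift of the closed geodesic to the orbifold
fundamental group `PSL(2, ℤ)`. -/
structure ParamClosedGeodesic where
  line : ℝ → ℍ
  isGeodesicLine : IsGeodesicLine line
  period : ℝ
  period_pos : 0 < period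
  lift : Modular
  lift_smul : ∀ t : ℝ, lift • line t = line (t + period)

/-- Two parametrized closed geodesics are the same closed geodesic if they have the same length and
their lines differ by an element of `PSL(2, ℤ)` and an isometric change of parameter
`t ↦ ± t + s` (change of base point and of orientation). -/
instance closedGeodesicSetoid : Setoid ParamClosedGeodesic where
  r x y := x.period = y.period ∧
    ∃ (h : Modular) (e : ℝ ≃ᵢ ℝ), ∀ t : ℝ, y.line t = h • x.line (e t)
  iseqv :=
    { refl := fun x => ⟨rfl, 1, IsometryEquiv.refl ℝ, fun t => (one_smul Modular _).symm⟩
      symm := by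
        rintro x y ⟨hp, h, e, he⟩
        exact ⟨hp.symm, h⁻¹, e.symm, fun t => by simp [he]⟩
      trans := by
        rintro x y z ⟨hp, h, e, he⟩ ⟨hp', h', e', he'⟩
        exact ⟨hp.trans hp', h' * h, e'.trans e, fun t => by simp [he, he', mul_smul]⟩ }

/-- Closed geodesics of the modular orbifold. -/
abbrev ClosedGeodesic : Type := Quotient closedGeodesicSetoid

/-- A closed geodesic is primitive if its lifts are primitive elements. -/
def ParamClosedGeodesic.IsPrimitive (x : ParamClosedGeodesic) : Prop :=
  IsPrimitiveElement x.lift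

/-- A closed geodesic is reciprocal if it passes through a cone point of even order, the order of
a cone point being the order of the stabilizer of a point of `ℍ` above it. -/
def ParamClosedGeodesic.IsReciprocal (x : ParamClosedGeodesic) : Prop :=
  ∃ t : ℝ, Even (Nat.card (MulAction.stabilizer Modular (x.line t)))

/-- The set of primitive reciprocal geodesics `γ` whose lifts have minimal word length at most `L`
in their conjugacy class. -/
def primitiveReciprocalGeodesics (L : ℝ) : Set ClosedGeodesic :=
  {γ | ∃ x : ParamClosedGeodesic, ⟦x⟧ = γ ∧ x.IsPrimitive ∧ x.IsReciprocal ∧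
    (classLength x.lift : ℝ) ≤ L}

end ModularOrbifold

namespace ModularOrbifold


/-! ### Elements of `PSL(2, ℤ)` as matrices up to sign -/

/-! The products `ιγ` and `ιγ⁻¹` are, up to sign, the unipotent matrices `(1 1; 0 1)` and `(1 0; 1
1)`. They generate a free monoid of nonnegative matrices, and every element of the modular group is
`a p b` with `p` in this monoid and `a`, `b` in `{1, ι}`; here `p` is unique (`eq_of_posWord_eq`,
`exists_eq_mul_posWord_mul`). A positive word of `k` letters has minimal length `2k` in its
conjugacy class (`classLength_posWord`).

A reciprocal geodesic can be moved so that it passes through `i`, where `ι` reverses it. If `f` is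
its lift, then `fι` is an involution, hence a conjugate of `ι`, and `f` becomes, up to conjugation
by `ι`, an element `p ι p⁻¹ ι` with `p` a positive word `w`. This is the positive word `w` followed
by its reversed negation, so its class length is `4|w|`. Conversely `p ι p⁻¹ ι` is represented by
the symmetric matrix `M Mᵀ`, whose axis passes through `i`. Since a hyperbolic element determines
its axis and translation length, counting geodesics is counting words with `|w| ≤ t/2`, up to
conjugacy of their elements (`primitiveReciprocalGeodesics_eq`).

A primitive reciprocal geodesic arises from exactly two words, `w` and `antiReverse w`, one for each
class of involutions in the infinite dihedral group generated by its lift and `ι`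
(`mk_reciprocalGeodesic_eq_iff`). With `K = ⌊t/2⌋` there are `2^(K+1) - 2` nonempty words. The
non-primitive ones come from powers of words of length at most `K/2`, so they number `O(K 2^(K/2))`.
Halving gives `N(t) ~ 2^K`. -/

lemma mk_eq_mk_iff {A B : SL(2, ℤ)} :
    (QuotientGroup.mk A : Modular) = QuotientGroup.mk B ↔ A = B ∨ A = -B := by
  rw [QuotientGroup.eq, Matrix.SpecialLinearGroup.mem_center_iff]
  constructor
  · rintro ⟨r, hr, h⟩
    have hr' : r = 1 ∨ r = -1 := by simpa using hr
    rcases hr' with rfl | rfl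
    · left
      have : A⁻¹ * B = 1 := Subtype.ext (by rw [← h]; simp)
      exact (inv_mul_eq_one.mp this)
    · right
      have : A⁻¹ * B = -1 := Subtype.ext (by rw [← h]; simp)
      rw [inv_mul_eq_iff_eq_mul] at this
      rw [this]; simp
  · rintro (rfl | rfl)
    · exact ⟨1, by simp, by simp⟩
    · refine ⟨-1, by simp, ?_⟩
      have : (-B)⁻¹ * B = -1 := by
        rw [inv_mul_eq_iff_eq_mul]; simp
      rw [this]; simp

lemma exists_mk (g : Modular) : ∃ A : SL(2, ℤ), QuotientGroup.mk A = g :=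
  QuotientGroup.mk_surjective g

lemma mk_mul (A B : SL(2, ℤ)) :
    (QuotientGroup.mk (A * B) : Modular) = QuotientGroup.mk A * QuotientGroup.mk B := rfl

lemma mk_neg (A : SL(2, ℤ)) : (QuotientGroup.mk (-A) : Modular) = QuotientGroup.mk A :=
  mk_eq_mk_iff.mpr (Or.inr rfl)

lemma mk_eq_one_iff {A : SL(2, ℤ)} :
    (QuotientGroup.mk A : Modular) = 1 ↔ A = 1 ∨ A = -1 :=
  mk_eq_mk_iff (B := 1)

lemma S_mul_apply_zero (A : SL(2, ℤ)) (j : Fin 2) : (ModularGroup.S * A) 0 j = - A 1 j := by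
  simp [ModularGroup.coe_S, Matrix.mul_apply, Fin.sum_univ_two, -Matrix.cons_mul]

lemma S_mul_apply_one (A : SL(2, ℤ)) (j : Fin 2) : (ModularGroup.S * A) 1 j = A 0 j := by
  simp [ModularGroup.coe_S, Matrix.mul_apply, Fin.sum_univ_two, -Matrix.cons_mul]

lemma mul_S_apply_zero (A : SL(2, ℤ)) (i : Fin 2) : (A * ModularGroup.S) i 0 = A i 1 := by
  simp [ModularGroup.coe_S, Matrix.mul_apply, Fin.sum_univ_two, -Matrix.cons_mul]

lemma mul_S_apply_one (A : SL(2, ℤ)) (i : Fin 2) : (A * ModularGroup.S) i 1 = - A i 0 := by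
  simp [ModularGroup.coe_S, Matrix.mul_apply, Fin.sum_univ_two, -Matrix.cons_mul]

lemma T_mul_apply_zero (A : SL(2, ℤ)) (j : Fin 2) :
    (ModularGroup.T * A) 0 j = A 0 j + A 1 j := by
  simp [ModularGroup.coe_T, Matrix.mul_apply, Fin.sum_univ_two, -Matrix.cons_mul]

lemma T_mul_apply_one (A : SL(2, ℤ)) (j : Fin 2) : (ModularGroup.T * A) 1 j = A 1 j := by
  simp

lemma T_inv_mul_apply_zero (A : SL(2, ℤ)) (j : Fin 2) :
    (ModularGroup.T⁻¹ * A) 0 j = A 0 j - A 1 j := by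
  simp [ModularGroup.coe_T_inv, Matrix.mul_apply, Fin.sum_univ_two, -Matrix.cons_mul,
    -Matrix.SpecialLinearGroup.coe_inv]
  ring

lemma T_inv_mul_apply_one (A : SL(2, ℤ)) (j : Fin 2) : (ModularGroup.T⁻¹ * A) 1 j = A 1 j := by
  simp

lemma neg_coe_apply (A : SL(2, ℤ)) (i j : Fin 2) : (-A) i j = - A i j := rfl

@[simp] lemma iota_mul_self : iota * iota = 1 := by
  rw [iota, ← mk_mul, mk_eq_one_iff]
  right; ext i j; fin_cases i <;> fin_cases j <;> simp [ModularGroup.coe_S]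

@[simp] lemma iota_inv : iota⁻¹ = iota := inv_eq_of_mul_eq_one_left iota_mul_self

@[simp] lemma iota_mul_iota_mul (g : Modular) : iota * (iota * g) = g := by
  rw [← mul_assoc, iota_mul_self, one_mul]

lemma iota_ne_one : iota ≠ 1 := by
  rw [iota, Ne, mk_eq_one_iff]
  rintro (h | h)
  · have := congrArg (fun M : SL(2, ℤ) => M 0 0) h; simp [ModularGroup.coe_S] at this
  · have := congrArg (fun M : SL(2, ℤ) => M 0 0) h; simp [ModularGroup.coe_S] at this

lemma gamma_mul_self : gamma * gamma = gamma⁻¹ := by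
  rw [eq_inv_iff_mul_eq_one, gamma, iota, alpha]
  simp only [← mk_mul]
  rw [mk_eq_one_iff]
  right
  ext i j; fin_cases i <;> fin_cases j <;>
    simp [ModularGroup.coe_S, ModularGroup.coe_T, Matrix.mul_apply, Fin.sum_univ_two]

lemma gamma_inv_mul_self : gamma⁻¹ * gamma⁻¹ = gamma := by
  rw [← mul_inv_rev, gamma_mul_self, inv_inv]

/-- An element commuting with `ι` is `1` or `ι`. -/
lemma eq_one_or_iota_of_commute {g : Modular} (h : g * iota = iota * g) : g = 1 ∨ g = iota := by
  obtain ⟨A, rfl⟩ := exists_mk g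
  rw [iota, ← mk_mul, ← mk_mul, mk_eq_mk_iff] at h
  have hd := A.det_coe
  rw [Matrix.det_fin_two] at hd
  have e00 : ∀ M : SL(2, ℤ), (A * ModularGroup.S = M) →
      A 0 1 = M 0 0 ∧ - A 0 0 = M 0 1 := by
    rintro M rfl
    simp only [mul_S_apply_zero, mul_S_apply_one, true_and]
  have key : A 1 0 = - A 0 1 ∧ A 1 1 = A 0 0 := by
    rcases h with h | h
    · obtain ⟨h1, h2⟩ := e00 _ h
      simp only [S_mul_apply_zero] at h1 h2
      constructor <;> linarith
    · obtain ⟨h1, h2⟩ := e00 _ h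
      simp only [S_mul_apply_zero, neg_coe_apply] at h1 h2
      -- If the lifts anticommute, the determinant is `-(a² + b²)`, which cannot be `1`.
      exfalso
      have h3 : A 1 0 = A 0 1 := by linarith
      have h4 : A 1 1 = - A 0 0 := by linarith
      rw [h3, h4] at hd
      nlinarith [sq_nonneg (A 0 0), sq_nonneg (A 0 1)]
  obtain ⟨k1, k2⟩ := key
  clear h e00
  rw [k1, k2] at hd
  have hb : A 0 1 = 0 ∨ A 0 0 = 0 := by
    by_contra! hne
    have h1 : 0 < A 0 1 ^ 2 := by have := hne.1; positivity
    have h2 : 0 < A 0 0 ^ 2 := by have := hne.2; positivity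
    nlinarith
  rcases hb with hb | ha
  · left
    rw [mk_eq_one_iff]
    have : A 0 0 = 1 ∨ A 0 0 = -1 := by
      rw [hb] at hd
      exact mul_self_eq_one_iff.mp (by linarith)
    rcases this with h1 | h1
    · left; ext i j; fin_cases i <;> fin_cases j <;> simp [*]
    · right; ext i j; fin_cases i <;> fin_cases j <;> simp [*]
  · right
    rw [iota, mk_eq_mk_iff]
    have : A 0 1 = 1 ∨ A 0 1 = -1 := by
      rw [ha] at hd
      exact mul_self_eq_one_iff.mp (by linarith)
    rcases this with h1 | h1
    · right; ext i j; fin_cases i <;> fin_cases j <;> simp [ModularGroup.coe_S, *]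
    · left; ext i j; fin_cases i <;> fin_cases j <;> simp [ModularGroup.coe_S, *]

/-! ### The positive monoid -/

/-- The letter `ι γ` or `ι γ⁻¹`. -/
def posLetter (e : Bool) : Modular := iota * (if e then gamma else gamma⁻¹)

/-- The product of the letters `ι γ ^ ± 1` prescribed by a word of signs. -/
def posWord (w : List Bool) : Modular := (w.map posLetter).prod

/-- The word of signs read backwards and with all signs changed. -/
def antiReverse (w : List Bool) : List Bool := (w.map not).reverse

@[simp] lemma posWord_nil : posWord [] = 1 := rfl

@[simp] lemma posWord_cons (e : Bool) (w : List Bool) :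
    posWord (e :: w) = posLetter e * posWord w := by simp [posWord]

@[simp] lemma posWord_append (v w : List Bool) :
    posWord (v ++ w) = posWord v * posWord w := by simp [posWord]

@[simp] lemma length_antiReverse (w : List Bool) : (antiReverse w).length = w.length := by
  simp [antiReverse]

@[simp] lemma antiReverse_eq_nil {w : List Bool} : antiReverse w = [] ↔ w = [] := by
  simp [antiReverse]

/-- Inversion followed by conjugation by `ι` is an anti-automorphism that exchanges the two letters
`ιγ` and `ιγ⁻¹`. -/
lemma posWord_antiReverse (w : List Bool) :
    posWord (antiReverse w) = iota * (posWord w)⁻¹ * iota := by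
  induction w with
  | nil => simp [antiReverse]
  | cons e w ih =>
    have : antiReverse (e :: w) = antiReverse w ++ [!e] := by simp [antiReverse]
    rw [this, posWord_append, ih]
    cases e <;> simp [posLetter, mul_assoc]

lemma posWord_replicate (w : List Bool) (n : ℕ) :
    posWord (List.replicate n w).flatten = posWord w ^ n := by
  induction n with
  | zero => simp
  | succ n ih => rw [List.replicate_succ, List.flatten_cons, posWord_append, ih, pow_succ']

/-- The matrix of a letter. -/
def posLetterMatrix (e : Bool) : SL(2, ℤ) :=
  if e then ModularGroup.T else -(ModularGroup.S * ModularGroup.T⁻¹ * ModularGroup.S)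

/-- The nonnegative matrix of a word of signs. -/
def posMatrix (w : List Bool) : SL(2, ℤ) := (w.map posLetterMatrix).prod

@[simp] lemma posMatrix_cons (e : Bool) (w : List Bool) :
    posMatrix (e :: w) = posLetterMatrix e * posMatrix w := by simp [posMatrix]

@[simp] lemma posMatrix_nil : posMatrix [] = 1 := rfl

lemma mk_posLetterMatrix (e : Bool) :
    (QuotientGroup.mk (posLetterMatrix e) : Modular) = posLetter e := by
  cases e
  · simp only [posLetterMatrix, posLetter, gamma, iota, alpha, Bool.false_eq_true, if_false, mk_neg]
    rw [mul_inv_rev, ← iota, iota_inv]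
    simp [iota, mul_assoc]
  · simp only [posLetterMatrix, posLetter, gamma, if_true, iota_mul_iota_mul]
    rfl

lemma mk_posMatrix (w : List Bool) :
    (QuotientGroup.mk (posMatrix w) : Modular) = posWord w := by
  induction w with
  | nil => rfl
  | cons e w ih => rw [posMatrix_cons, mk_mul, ih, mk_posLetterMatrix, posWord_cons]

lemma posMatrix_cons_apply (e : Bool) (w : List Bool) (j : Fin 2) :
    posMatrix (e :: w) 0 j = (if e then posMatrix w 0 j + posMatrix w 1 j else posMatrix w 0 j) ∧
    posMatrix (e :: w) 1 j = (if e then posMatrix w 1 j else posMatrix w 0 j + posMatrix w 1 j) := by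
  cases e
  · have : posMatrix (false :: w) =
        -(ModularGroup.S * (ModularGroup.T⁻¹ * (ModularGroup.S * posMatrix w))) := by
      simp [posLetterMatrix, mul_assoc]
    rw [this]
    simp only [neg_coe_apply, S_mul_apply_zero, S_mul_apply_one, T_inv_mul_apply_zero,
      T_inv_mul_apply_one, Bool.false_eq_true, if_false]
    constructor <;> ring
  · simp only [posMatrix_cons, posLetterMatrix, if_true, T_mul_apply_zero, T_mul_apply_one, true_and]

lemma posMatrix_nonneg (w : List Bool) (i j : Fin 2) : 0 ≤ posMatrix w i j := by
  induction w generalizing i j with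
  | nil => fin_cases i <;> fin_cases j <;> simp
  | cons e w ih =>
    have h := posMatrix_cons_apply e w j
    have h0 := ih 0 j
    have h1 := ih 1 j
    fin_cases i
    · simp only [Fin.zero_eta, h.1]; split_ifs <;> omega
    · simp only [Fin.mk_one, h.2]; split_ifs <;> omega

lemma posMatrix_det (w : List Bool) :
    posMatrix w 0 0 * posMatrix w 1 1 - posMatrix w 0 1 * posMatrix w 1 0 = 1 := by
  have := (posMatrix w).det_coe
  rwa [Matrix.det_fin_two] at this

/-- The first letter can be read off: `true` adds the bottom row to the top one, `false` the top row
to the bottom one. A matrix of both kinds would have equal rows and determinant `0`. -/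
lemma posMatrix_injective : Function.Injective posMatrix := by
  have hone : ∀ (e : Bool) (w : List Bool), posMatrix (e :: w) ≠ 1 := by
    intro e w h
    have h0 := posMatrix_cons_apply e w 0
    have h1 := posMatrix_cons_apply e w 1
    rw [h] at h0 h1
    have p00 := posMatrix_nonneg w 0 0
    have p01 := posMatrix_nonneg w 0 1
    have p10 := posMatrix_nonneg w 1 0
    have p11 := posMatrix_nonneg w 1 1
    cases e <;> simp at h0 h1 <;> omega
  have hne : ∀ v w : List Bool, posMatrix (true :: v) ≠ posMatrix (false :: w) := by
    intro v w h
    have hd := posMatrix_det (true :: v)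
    have h0 := posMatrix_cons_apply true v 0
    have h1 := posMatrix_cons_apply true v 1
    have k0 := posMatrix_cons_apply false w 0
    have k1 := posMatrix_cons_apply false w 1
    rw [← h] at k0 k1
    have p0 := posMatrix_nonneg v 0 0
    have p1 := posMatrix_nonneg v 0 1
    have q0 := posMatrix_nonneg w 1 0
    have q1 := posMatrix_nonneg w 1 1
    simp only [if_true, Bool.false_eq_true, if_false] at h0 h1 k0 k1
    have e0 : posMatrix (true :: v) 0 0 = posMatrix (true :: v) 1 0 := by omega
    have e1 : posMatrix (true :: v) 0 1 = posMatrix (true :: v) 1 1 := by omega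
    rw [e0, e1] at hd
    have : (0 : ℤ) = 1 := by linarith
    omega
  intro v
  induction v with
  | nil =>
    intro w h
    cases w with
    | nil => rfl
    | cons e w => exact absurd h.symm (hone e w)
  | cons e v ih =>
    intro w h
    cases w with
    | nil => exact absurd h (hone e v)
    | cons f w =>
      cases e <;> cases f
      · rw [posMatrix_cons, posMatrix_cons] at h
        rw [ih (mul_left_cancel h)]
      · exact absurd h.symm (hne w v)
      · exact absurd h (hne v w)
      · rw [posMatrix_cons, posMatrix_cons] at h
        rw [ih (mul_left_cancel h)]

lemma posWord_injective : Function.Injective posWord := by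
  intro v w h
  rw [← mk_posMatrix, ← mk_posMatrix, mk_eq_mk_iff] at h
  rcases h with h | h
  · exact posMatrix_injective h
  · exfalso
    have hh : ∀ i j, posMatrix v i j = 0 := by
      intro i j
      have h1 := posMatrix_nonneg v i j
      have h2 := posMatrix_nonneg w i j
      have h3 : posMatrix v i j = - posMatrix w i j := by rw [h]; simp
      omega
    have := posMatrix_det v
    simp [hh] at this

lemma posWord_eq_one_iff {w : List Bool} : posWord w = 1 ↔ w = [] :=
  ⟨fun h => posWord_injective (h.trans posWord_nil.symm), fun h => by rw [h, posWord_nil]⟩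

/-- Left multiplication by `S` makes the two rows of a nonnegative matrix opposite in sign. For
either choice of sign, one row of `posMatrix v` would vanish, against the determinant. -/
lemma posWord_ne_iota_mul (v w : List Bool) : posWord v ≠ iota * posWord w := by
  intro h
  rw [← mk_posMatrix, ← mk_posMatrix, iota, ← mk_mul, mk_eq_mk_iff] at h
  have hv := posMatrix_nonneg v
  have hw := posMatrix_nonneg w
  have dv := posMatrix_det v
  have e : posMatrix v 0 0 * posMatrix w 1 0 = 0 ∧ posMatrix v 0 1 = 0 ∧ posMatrix w 1 1 = 0 ∨
      posMatrix v 1 0 = 0 ∧ posMatrix v 1 1 = 0 := by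
    rcases h with h | h
    · have h00 : posMatrix v 0 0 = - posMatrix w 1 0 := by
        rw [h]; simp only [S_mul_apply_zero]
      have h01 : posMatrix v 0 1 = - posMatrix w 1 1 := by
        rw [h]; simp only [S_mul_apply_zero]
      have := hv 0 0; have := hv 0 1; have := hw 1 0; have := hw 1 1
      left
      refine ⟨?_, by omega, by omega⟩
      rw [show posMatrix v 0 0 = 0 by omega, zero_mul]
    · have h10 : posMatrix v 1 0 = - posMatrix w 0 0 := by
        rw [h]; simp only [S_mul_apply_one, neg_coe_apply]
      have h11 : posMatrix v 1 1 = - posMatrix w 0 1 := by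
        rw [h]; simp only [S_mul_apply_one, neg_coe_apply]
      have := hv 1 0; have := hv 1 1; have := hw 0 0; have := hw 0 1
      right
      constructor <;> omega
  have dw := posMatrix_det w
  rcases e with ⟨e1, e2, e3⟩ | ⟨e1, e2⟩
  · rw [e2, zero_mul, sub_zero] at dv
    rw [e3, mul_zero, zero_sub] at dw
    have := mul_nonneg (hw 0 1) (hw 1 0)
    omega
  · rw [e1, e2] at dv; simp at dv

lemma posWord_ne_mul_iota (v w : List Bool) : posWord v ≠ posWord w * iota := by
  intro h
  apply posWord_ne_iota_mul (antiReverse v) (antiReverse w)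
  simp [posWord_antiReverse, h, mul_assoc]

/-- Conjugation by `S` gives the diagonal and the off-diagonal entries opposite signs, so one of the
two pairs vanishes. The determinant excludes a zero diagonal, and a nonnegative diagonal matrix of
determinant one is the identity. -/
lemma eq_nil_of_posWord_eq_iota_mul_iota {v w : List Bool}
    (h : posWord v = iota * posWord w * iota) : v = [] ∧ w = [] := by
  rw [← mk_posMatrix, ← mk_posMatrix, iota, ← mk_mul, ← mk_mul, mk_eq_mk_iff] at h
  have hv := posMatrix_nonneg v
  have hw := posMatrix_nonneg w
  have dv := posMatrix_det v
  have dw := posMatrix_det w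
  have key : ∀ M : SL(2, ℤ), posMatrix v = M → posMatrix v 0 0 = M 0 0 ∧ posMatrix v 0 1 = M 0 1 ∧
      posMatrix v 1 0 = M 1 0 ∧ posMatrix v 1 1 = M 1 1 := by
    rintro M rfl; simp
  have hv00 := hv 0 0; have hv01 := hv 0 1; have hv10 := hv 1 0; have hv11 := hv 1 1
  have hw00 := hw 0 0; have hw01 := hw 0 1; have hw10 := hw 1 0; have hw11 := hw 1 1
  rcases h with h | h
  · obtain ⟨h1, h2, h3, h4⟩ := key _ h
    simp only [S_mul_apply_zero, S_mul_apply_one, mul_S_apply_zero, mul_S_apply_one] at h1 h2 h3 h4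
    have e1 : posMatrix v 0 0 = 0 := by omega
    rw [e1, zero_mul] at dv
    have := mul_nonneg hv01 hv10
    omega
  · obtain ⟨h1, h2, h3, h4⟩ := key _ h
    simp only [S_mul_apply_zero, S_mul_apply_one, mul_S_apply_zero, mul_S_apply_one,
        neg_coe_apply] at h1 h2 h3 h4
    have e1 : posMatrix v 0 1 = 0 := by omega
    have e2 : posMatrix v 1 0 = 0 := by omega
    have f1 : posMatrix w 0 1 = 0 := by omega
    have f2 : posMatrix w 1 0 = 0 := by omega
    have aux : ∀ u : List Bool, posMatrix u 0 1 = 0 → posMatrix u 1 0 = 0 → u = [] := by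
      intro u a b
      apply posMatrix_injective
      have d := posMatrix_det u
      have p0 := posMatrix_nonneg u 0 0
      have p1 := posMatrix_nonneg u 1 1
      rw [a, zero_mul, sub_zero] at d
      have c := Int.eq_one_or_neg_one_of_mul_eq_one d
      have c0 : posMatrix u 0 0 = 1 := by omega
      rw [c0, one_mul] at d
      ext i j; fin_cases i <;> fin_cases j <;> simp [a, b, c0, d]
    exact ⟨aux v e1 e2, aux w f1 f2⟩

/-- The double coset of a positive word modulo `⟨ι⟩` determines the word. -/
lemma eq_of_posWord_eq {v w : List Bool} {a b : Modular} (ha : a = 1 ∨ a = iota)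
    (hb : b = 1 ∨ b = iota) (h : posWord v = a * posWord w * b) : v = w := by
  rcases ha with rfl | rfl <;> rcases hb with rfl | rfl
  · exact posWord_injective (by simpa using h)
  · exact absurd (by simpa using h) (posWord_ne_mul_iota v w)
  · exact absurd (by simpa using h) (posWord_ne_iota_mul v w)
  · obtain ⟨rfl, rfl⟩ := eq_nil_of_posWord_eq_iota_mul_iota h
    rfl

/-! ### Normal forms and word length -/

/-- The condition on the letters of a word. -/
def IsLetter (x : Modular) : Prop := x = iota ∨ x = gamma ∨ x = gamma⁻¹

lemma exists_word (g : Modular) : ∃ w : List Modular, (∀ x ∈ w, IsLetter x) ∧ w.prod = g := by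
  have hS : Subgroup.closure ({iota, gamma} : Set Modular) = ⊤ := by
    rw [eq_top_iff]
    have h : Subgroup.map (QuotientGroup.mk' (Subgroup.center SL(2, ℤ)))
        (Subgroup.closure {ModularGroup.S, ModularGroup.T}) = ⊤ := by
      rw [SpecialLinearGroup.SL2Z_generators]
      exact Subgroup.map_top_of_surjective _ (QuotientGroup.mk'_surjective _)
    rw [← h, MonoidHom.map_closure, Subgroup.closure_le]
    have hi : iota ∈ Subgroup.closure ({iota, gamma} : Set Modular) :=
      Subgroup.subset_closure (by simp)
    have hg : gamma ∈ Subgroup.closure ({iota, gamma} : Set Modular) :=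
      Subgroup.subset_closure (by simp)
    rintro _ ⟨A, hA | hA, rfl⟩
    · rw [hA]; exact hi
    · rw [hA]
      have : iota * gamma = alpha := by simp [gamma]
      change alpha ∈ _
      rw [← this]
      exact mul_mem hi hg
  have hg : g ∈ Subgroup.closure ({iota, gamma} : Set Modular) := by rw [hS]; trivial
  induction hg using Subgroup.closure_induction with
  | mem x hx =>
    refine ⟨[x], ?_, by simp⟩
    rcases hx with rfl | rfl <;> simp [IsLetter]
  | one => exact ⟨[], by simp, rfl⟩
  | mul x y _ _ hx hy =>
    obtain ⟨v, hv, rfl⟩ := hx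
    obtain ⟨w, hw, rfl⟩ := hy
    refine ⟨v ++ w, ?_, by simp⟩
    intro x hx
    rcases List.mem_append.mp hx with h | h
    exacts [hv x h, hw x h]
  | inv x _ hx =>
    obtain ⟨v, hv, rfl⟩ := hx
    refine ⟨(v.map (·⁻¹)).reverse, ?_, by rw [List.prod_inv_reverse]⟩
    intro x hx
    simp only [List.mem_reverse, List.mem_map] at hx
    obtain ⟨y, hy, rfl⟩ := hx
    rcases hv y hy with rfl | rfl | rfl <;> simp [IsLetter]

/-- A word can be rewritten as an alternating word without increasing its length. -/
lemma exists_normal_form (w : List Modular) (hw : ∀ x ∈ w, IsLetter x) :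
    ∃ (u : List Bool) (y : Modular), (y = 1 ∨ y = iota) ∧
      ((w.prod = posWord u * y ∧ 2 * u.length ≤ w.length) ∨
        ∃ e : Bool, w.prod = iota * posWord (e :: u) * y ∧ 2 * u.length + 1 ≤ w.length) := by
  -- In the second alternative the leading `ι` cancels the one in the first letter `e`, which leaves
  -- `γ^±1` before `posWord u` and accounts for `2 * u.length + 1`. The final `y` is left uncounted,
  -- as only a lower bound for the length is needed.
  induction w with
  | nil => exact ⟨[], 1, Or.inl rfl, Or.inl (by simp)⟩
  | cons a w ih =>
    obtain ⟨u, y, hy, h⟩ := ih fun x hx => hw x (List.mem_cons_of_mem _ hx)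
    have ha : a = iota ∨ ∃ f : Bool, a = iota * posLetter f := by
      rcases hw a List.mem_cons_self with h | h | h
      · exact Or.inl h
      · exact Or.inr ⟨true, by simp [posLetter, h]⟩
      · exact Or.inr ⟨false, by simp [posLetter, h]⟩
    simp only [List.prod_cons, List.length_cons]
    rcases h with ⟨h, hl⟩ | ⟨e, h, hl⟩ <;> rw [h] <;> rcases ha with rfl | ⟨f, rfl⟩
    · rcases u with _ | ⟨e, u⟩
      · refine ⟨[], iota * y, ?_, Or.inl ⟨by simp, by simp⟩⟩
        rcases hy with rfl | rfl <;> simp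
      · refine ⟨u, y, hy, Or.inr ⟨e, by rw [mul_assoc], ?_⟩⟩
        simp only [List.length_cons] at hl; omega
    · exact ⟨u, y, hy, Or.inr ⟨f, by simp [mul_assoc], by omega⟩⟩
    · refine ⟨e :: u, y, hy, Or.inl ⟨by simp [mul_assoc], ?_⟩⟩
      simp only [List.length_cons]; omega
    · have hinv : gamma * (gamma * (posWord u * y)) = gamma⁻¹ * (posWord u * y) := by
        rw [← mul_assoc, gamma_mul_self]
      have hinv' : gamma⁻¹ * (gamma⁻¹ * (posWord u * y)) = gamma * (posWord u * y) := by
        rw [← mul_assoc, gamma_inv_mul_self]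
      rcases e <;> rcases f
      · refine ⟨u, y, hy, Or.inr ⟨true, ?_, by omega⟩⟩
        simpa [posLetter, mul_assoc] using hinv'
      · refine ⟨u, y, hy, Or.inl ⟨?_, by omega⟩⟩
        simp [posLetter, mul_assoc]
      · refine ⟨u, y, hy, Or.inl ⟨?_, by omega⟩⟩
        simp [posLetter, mul_assoc]
      · refine ⟨u, y, hy, Or.inr ⟨false, ?_, by omega⟩⟩
        simpa [posLetter, mul_assoc] using hinv

/-- Every element lies in the double coset of a positive word modulo `⟨ι⟩`. -/
lemma exists_eq_mul_posWord_mul (g : Modular) : ∃ (u : List Bool) (a b : Modular),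
    (a = 1 ∨ a = iota) ∧ (b = 1 ∨ b = iota) ∧ g = a * posWord u * b := by
  obtain ⟨w, hw, rfl⟩ := exists_word g
  obtain ⟨u, y, hy, ⟨h, -⟩ | ⟨e, h, -⟩⟩ := exists_normal_form w hw
  · exact ⟨u, 1, y, Or.inl rfl, hy, by rw [h, one_mul]⟩
  · exact ⟨e :: u, iota, y, Or.inr rfl, hy, h⟩

lemma two_mul_length_le_of_prod_eq {w : List Modular} (hw : ∀ x ∈ w, IsLetter x) {v : List Bool}
    (h : w.prod = posWord v) : 2 * v.length ≤ w.length := by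
  obtain ⟨u, y, hy, ⟨h', hl⟩ | ⟨e, h', hl⟩⟩ := exists_normal_form w hw
  · have := eq_of_posWord_eq (v := v) (w := u) (Or.inl rfl) hy (by rw [← h, h', one_mul])
    rwa [this]
  · exfalso
    rw [h] at h'
    rcases hy with rfl | rfl
    · exact posWord_ne_iota_mul v (e :: u) (by simpa using h')
    · have := (eq_nil_of_posWord_eq_iota_mul_iota h').2
      simp at this

lemma wordLength_set_nonempty (g : Modular) : {n : ℕ | ∃ w : List Modular,
    (∀ x ∈ w, x = iota ∨ x = gamma ∨ x = gamma⁻¹) ∧ w.prod = g ∧ w.length = n}.Nonempty := by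
  obtain ⟨w, hw, h⟩ := exists_word g
  exact ⟨w.length, w, hw, h, rfl⟩

lemma exists_word_length_eq (g : Modular) : ∃ w : List Modular,
    (∀ x ∈ w, IsLetter x) ∧ w.prod = g ∧ w.length = wordLength g :=
  Nat.sInf_mem (wordLength_set_nonempty g)

lemma wordLength_prod_le {w : List Modular} (hw : ∀ x ∈ w, IsLetter x) :
    wordLength w.prod ≤ w.length := Nat.sInf_le ⟨w, hw, rfl, rfl⟩

lemma wordLength_mul_le (g h : Modular) : wordLength (g * h) ≤ wordLength g + wordLength h := by
  obtain ⟨v, hv, rfl, hvl⟩ := exists_word_length_eq g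
  obtain ⟨w, hw, rfl, hwl⟩ := exists_word_length_eq h
  rw [← List.prod_append, ← hvl, ← hwl, ← List.length_append]
  refine wordLength_prod_le fun x hx => ?_
  rcases List.mem_append.mp hx with h | h
  exacts [hv x h, hw x h]

lemma wordLength_pow_le (g : Modular) (n : ℕ) : wordLength (g ^ n) ≤ n * wordLength g := by
  induction n with
  | zero => simpa using wordLength_prod_le (w := []) (by simp)
  | succ n ih =>
    rw [pow_succ, add_mul, one_mul]
    exact (wordLength_mul_le _ _).trans (by omega)

lemma two_mul_length_le_wordLength (v : List Bool) : 2 * v.length ≤ wordLength (posWord v) := by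
  obtain ⟨w, hw, h, hl⟩ := exists_word_length_eq (posWord v)
  rw [← hl]
  exact two_mul_length_le_of_prod_eq hw h

lemma wordLength_posWord_le (v : List Bool) : wordLength (posWord v) ≤ 2 * v.length := by
  induction v with
  | nil => simpa using wordLength_prod_le (w := []) (by simp)
  | cons e v ih =>
    rw [posWord_cons, List.length_cons]
    have : wordLength (posLetter e) ≤ 2 := by
      have h := wordLength_prod_le (w := [iota, if e then gamma else gamma⁻¹]) (by
        cases e <;> simp [IsLetter])
      simpa [posLetter] using h
    have := wordLength_mul_le (posLetter e) (posWord v)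
    omega

/-- A conjugate of a positive word is not shorter than the positive word: compare powers. -/
lemma two_mul_length_le_of_isConj {v : List Bool} {h : Modular} (hc : IsConj (posWord v) h) :
    2 * v.length ≤ wordLength h := by
  obtain ⟨c, hc⟩ := isConj_iff.mp hc
  by_contra! hlt
  -- Passing to `n`-th powers multiplies both lengths by at most `n`, exactly so for the positive
  -- word, while the cost of conjugating by `c` stays bounded. Any `n` above this cost contradicts
  -- `hlt`.
  have key : ∀ n : ℕ, n * (2 * v.length) ≤ wordLength c⁻¹ + n * wordLength h + wordLength c := by
    intro n
    have h1 : posWord v ^ n = c⁻¹ * h ^ n * c := by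
      rw [← hc, conj_pow]; group
    have h2 := two_mul_length_le_wordLength (List.replicate n v).flatten
    rw [posWord_replicate, h1] at h2
    have h3 := wordLength_mul_le (c⁻¹ * h ^ n) c
    have h4 := wordLength_mul_le c⁻¹ (h ^ n)
    have h5 := wordLength_pow_le h n
    have h6 : (List.replicate n v).flatten.length = n * v.length := by simp
    rw [h6] at h2
    calc n * (2 * v.length) = 2 * (n * v.length) := by ring
      _ ≤ _ := by omega
  have := key (wordLength c⁻¹ + wordLength c + 1)
  have h7 := Nat.mul_le_mul_left (wordLength c⁻¹ + wordLength c + 1) (Nat.succ_le_of_lt hlt)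
  rw [Nat.succ_eq_add_one, mul_add, mul_one] at h7
  omega

lemma classLength_posWord (v : List Bool) : classLength (posWord v) = 2 * v.length := by
  apply le_antisymm
  · exact (Nat.sInf_le ⟨posWord v, IsConj.refl _, rfl⟩ : classLength (posWord v) ≤ _).trans
      (wordLength_posWord_le v)
  · obtain ⟨h, hc, hl⟩ := Nat.sInf_mem (s := {n : ℕ | ∃ h : Modular,
      IsConj (posWord v) h ∧ wordLength h = n}) ⟨_, posWord v, IsConj.refl _, rfl⟩
    rw [classLength, ← hl]
    exact two_mul_length_le_of_isConj hc

lemma classLength_eq_of_isConj {g h : Modular} (hc : IsConj g h) :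
    classLength g = classLength h := by
  unfold classLength
  congr 1
  ext n
  exact exists_congr fun k => and_congr_left fun _ => ⟨fun h' => hc.symm.trans h', hc.trans⟩

/-! ### Involutions and reciprocal words -/

/-- The length is even because a middle letter would equal its own negation. -/
lemma exists_eq_append_antiReverse {u : List Bool} (h : antiReverse u = u) :
    ∃ w, u = w ++ antiReverse w := by
  have hn : u.length % 2 = 0 := by
    by_contra hodd
    obtain ⟨m, hm⟩ : ∃ m, u.length = 2 * m + 1 := ⟨u.length / 2, by omega⟩
    have h1 : (antiReverse u)[m]? = u[m]? := by rw [h]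
    have h2 : m < u.length := by omega
    have h3 : m < (u.map not).length := by simpa using h2
    rw [antiReverse, List.getElem?_reverse h3, List.getElem?_map] at h1
    have h4 : (u.map not).length - 1 - m = m := by simp; omega
    rw [h4, List.getElem?_eq_getElem h2] at h1
    simp at h1
  obtain ⟨m, hm⟩ : ∃ m, u.length = m + m := ⟨u.length / 2, by omega⟩
  refine ⟨u.take m, ?_⟩
  have : antiReverse (u.take m) = u.drop m := by
    conv_rhs => rw [← h]
    rw [antiReverse, antiReverse, List.drop_reverse, List.map_take]
    simp [hm]
  rw [this, List.take_append_drop]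

/-- Every involution is conjugate to `ι`. -/
lemma exists_eq_conj_iota {k : Modular} (hk : k * k = 1) (hk1 : k ≠ 1) :
    ∃ h : Modular, k = h * iota * h⁻¹ := by
  obtain ⟨u, a, b, ha, hb, rfl⟩ := exists_eq_mul_posWord_mul k
  -- That `ι posWord u` squares to `1` says that `u` is fixed by `antiReverse`. Writing `u` as `w ++
  -- antiReverse w` exhibits the conjugating element `ι posWord w`.
  have main : ∀ u : List Bool, (iota * posWord u) * (iota * posWord u) = 1 →
      ∃ h : Modular, iota * posWord u = h * iota * h⁻¹ := by
    intro u hu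
    have h1 : posWord (antiReverse u) = posWord u := by
      rw [posWord_antiReverse]
      have : iota * posWord u * iota = (posWord u)⁻¹ := by
        rw [eq_inv_iff_mul_eq_one, mul_assoc, hu]
      rw [← this]; simp [mul_assoc]
    obtain ⟨w, hw⟩ := exists_eq_append_antiReverse (posWord_injective h1)
    refine ⟨iota * posWord w, ?_⟩
    rw [hw, posWord_append, posWord_antiReverse]
    simp [mul_assoc]
  have main' : ∀ u : List Bool, posWord u * posWord u = 1 → posWord u = 1 := by
    intro u hu
    rw [← posWord_append, posWord_eq_one_iff, List.append_eq_nil_iff] at hu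
    rw [hu.1, posWord_nil]
  rcases ha with rfl | rfl <;> rcases hb with rfl | rfl
  · simp only [one_mul, mul_one] at hk hk1
    exact absurd (main' u hk) hk1
  · simp only [one_mul] at hk
    obtain ⟨h, hh⟩ := main u (by
      have := congrArg (fun x => iota * x * iota) hk
      simpa [mul_assoc] using this)
    refine ⟨iota * h, ?_⟩
    have := congrArg (fun x => iota * x * iota) hh
    simpa [mul_assoc] using this
  · simp only [mul_one] at hk ⊢
    exact main u hk
  · exfalso
    have h1 : posWord u * posWord u = 1 := by
      have := congrArg (fun x => iota * x * iota) hk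
      simpa [mul_assoc] using this
    apply hk1
    rw [main' u h1]; simp

/-- The reciprocal element `p ι p⁻¹ ι` of a word `p`. -/
def reciprocalElement (w : List Bool) : Modular := posWord (w ++ antiReverse w)

lemma reciprocalElement_eq (w : List Bool) :
    reciprocalElement w = posWord w * iota * (posWord w)⁻¹ * iota := by
  rw [reciprocalElement, posWord_append, posWord_antiReverse]
  simp [mul_assoc]

lemma classLength_reciprocalElement (w : List Bool) :
    classLength (reciprocalElement w) = 4 * w.length := by
  rw [reciprocalElement, classLength_posWord]; simp; ring

lemma reciprocalElement_ne_one {w : List Bool} (hw : w ≠ []) : reciprocalElement w ≠ 1 := by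
  rw [reciprocalElement, Ne, posWord_eq_one_iff]; simp [hw]

lemma iota_mul_reciprocalElement_mul_iota (w : List Bool) :
    iota * reciprocalElement w * iota = (reciprocalElement w)⁻¹ := by
  rw [reciprocalElement_eq]; simp [mul_assoc]

/-- The word of a reciprocal element is determined by the element up to conjugation by `ι`. -/
lemma eq_of_reciprocalElement_eq {v w : List Bool}
    (h : reciprocalElement v = reciprocalElement w ∨
      reciprocalElement v = iota * reciprocalElement w * iota) : v = w := by
  obtain ⟨a, ha, h'⟩ : ∃ a, (a = 1 ∨ a = iota) ∧
      (posWord v) * iota * (posWord v)⁻¹ = (a * posWord w) * iota * (a * posWord w)⁻¹ := by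
    simp only [reciprocalElement_eq] at h
    rcases h with h | h
    · exact ⟨1, Or.inl rfl, by simpa using h⟩
    · refine ⟨iota, Or.inr rfl, ?_⟩
      have := congrArg (· * iota) h
      simpa [mul_assoc] using this
  -- Equal conjugates of `ι` have conjugating elements that differ by the centralizer `{1, ι}` of
  -- `ι`, so the double coset of the word is determined.
  have hc : ((a * posWord w)⁻¹ * posWord v) * iota = iota * ((a * posWord w)⁻¹ * posWord v) := by
    have := congrArg (fun x => (a * posWord w)⁻¹ * x * posWord v) h'
    simpa [mul_assoc] using this
  have hb := eq_one_or_iota_of_commute hc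
  refine eq_of_posWord_eq ha hb (w := w) ?_
  group

/-- This conjugation is the source of the factor two in the count: it moves the base point to the
other passage through the cone point. -/
lemma reciprocalElement_antiReverse (w : List Bool) :
    reciprocalElement (antiReverse w) =
      (posWord w)⁻¹ * reciprocalElement w * posWord w := by
  rw [reciprocalElement_eq, reciprocalElement_eq, posWord_antiReverse]
  simp [mul_assoc]

/-- The product of two involutions `j ι` with `j ≠ ι` is a reciprocal element up to conjugation
by `ι`. -/
lemma exists_reciprocalElement {j : Modular} (hj : j * j = 1) (hj1 : j ≠ 1) (hji : j ≠ iota) :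
    ∃ w : List Bool, w ≠ [] ∧ (j * iota = reciprocalElement w ∨
      j * iota = iota * reciprocalElement w * iota) := by
  obtain ⟨h, rfl⟩ := exists_eq_conj_iota hj hj1
  obtain ⟨u, a, b, ha, hb, rfl⟩ := exists_eq_mul_posWord_mul h
  have hconj : (a * posWord u * b) * iota * (a * posWord u * b)⁻¹ =
      (a * posWord u) * iota * (a * posWord u)⁻¹ := by
    rcases hb with rfl | rfl <;> simp [mul_assoc]
  rw [hconj] at hji ⊢
  refine ⟨u, ?_, ?_⟩
  · rintro rfl
    apply hji
    rcases ha with rfl | rfl <;> simp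
  · rw [reciprocalElement_eq]
    rcases ha with rfl | rfl <;> simp [mul_assoc]


/-! ### Translations along geodesic lines -/

/-- The real matrix of an integral matrix. -/
def realMatrix : SL(2, ℤ) →* SL(2, ℝ) := Matrix.SpecialLinearGroup.map (Int.castRingHom ℝ)

lemma realMatrix_apply (A : SL(2, ℤ)) (i j : Fin 2) : realMatrix A i j = (A i j : ℝ) := rfl

lemma realMatrix_smul (A : SL(2, ℤ)) (z : ℍ) : realMatrix A • z = A • z := by
  ext
  rw [UpperHalfPlane.coe_specialLinearGroup_apply, UpperHalfPlane.coe_specialLinearGroup_apply]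
  simp [realMatrix_apply]

lemma det_real (M : SL(2, ℝ)) : M 0 0 * M 1 1 - M 0 1 * M 1 0 = 1 := by
  have := M.det_coe
  rwa [Matrix.det_fin_two] at this

lemma smul_eq_iff (M : SL(2, ℝ)) (z w : ℍ) :
    M • z = w ↔ (M 0 0 : ℂ) * z + M 0 1 = w * ((M 1 0 : ℂ) * z + M 1 1) := by
  rw [UpperHalfPlane.ext_iff, UpperHalfPlane.coe_specialLinearGroup_apply, div_eq_iff]
  · rfl
  · exact UpperHalfPlane.denom_ne_zero (M : GL (Fin 2) ℝ) z

lemma smul_verticalGeodesic_eq_iff (M : SL(2, ℝ)) (t t' : ℝ) :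
    M • verticalGeodesic t = verticalGeodesic t' ↔
      M 0 1 = - M 1 0 * Real.exp t * Real.exp t' ∧ M 0 0 * Real.exp t = M 1 1 * Real.exp t' := by
  rw [smul_eq_iff, Complex.ext_iff]
  simp [verticalGeodesic]
  constructor
  · rintro ⟨h1, h2⟩; constructor <;> linarith
  · rintro ⟨h1, h2⟩; constructor <;> linarith

/-- The hyperbolic translation of length `s` along the imaginary axis. -/
noncomputable def translation (s : ℝ) : SL(2, ℝ) :=
  ⟨!![Real.exp (s / 2), 0; 0, Real.exp (-(s / 2))], by
    rw [Matrix.det_fin_two_of, ← Real.exp_add]; simp⟩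

@[simp] lemma translation_apply_zero_zero (s : ℝ) : translation s 0 0 = Real.exp (s / 2) := rfl
@[simp] lemma translation_apply_zero_one (s : ℝ) : translation s 0 1 = 0 := rfl
@[simp] lemma translation_apply_one_zero (s : ℝ) : translation s 1 0 = 0 := rfl
@[simp] lemma translation_apply_one_one (s : ℝ) : translation s 1 1 = Real.exp (-(s / 2)) := rfl

lemma translation_smul (s t : ℝ) :
    translation s • verticalGeodesic t = verticalGeodesic (t + s) := by
  rw [smul_verticalGeodesic_eq_iff]
  constructor
  · simp
  · simp only [translation_apply_zero_zero, translation_apply_one_one, ← Real.exp_add]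
    congr 1; ring

/-- Comparing the images of the points at `0` and `1` already makes `M` diagonal, and the
determinant then fixes it up to sign. -/
lemma eq_or_eq_neg_translation {M : SL(2, ℝ)} {s : ℝ}
    (h : ∀ t, M • verticalGeodesic t = verticalGeodesic (t + s)) :
    M = translation s ∨ M = -translation s := by
  obtain ⟨b0, a0⟩ := (smul_verticalGeodesic_eq_iff M _ _).mp (h 0)
  obtain ⟨b1, -⟩ := (smul_verticalGeodesic_eq_iff M _ _).mp (h 1)
  rw [Real.exp_zero, zero_add, mul_one] at b0 a0
  rw [add_comm 1 s, Real.exp_add] at b1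
  have hs : Real.exp s = Real.exp (s / 2) ^ 2 := by
    rw [← Real.exp_nat_mul]; congr 1; push_cast; ring
  have hc : M 1 0 = 0 := by
    have e1 : 1 < Real.exp 1 := by simp
    have : M 1 0 * (Real.exp s * (Real.exp 1 ^ 2 - 1)) = 0 := by linear_combination b1 - b0
    rcases mul_eq_zero.mp this with h | h
    · exact h
    · exfalso
      have : 0 < Real.exp s * (Real.exp 1 ^ 2 - 1) := by
        apply mul_pos (Real.exp_pos s); nlinarith
      linarith
  have hb : M 0 1 = 0 := by rw [b0, hc]; simp
  have hd := det_real M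
  rw [hc, hb] at hd
  have hinv : Real.exp (-(s / 2)) * Real.exp (s / 2) = 1 := by rw [← Real.exp_add]; simp
  have h1 : (M 1 1 * Real.exp (s / 2)) * (M 1 1 * Real.exp (s / 2)) = 1 := by
    rw [hs] at a0; linear_combination hd - M 1 1 * a0
  have hne := (Real.exp_pos (s / 2)).ne'
  rcases mul_self_eq_one_iff.mp h1 with h2 | h2
  · left
    have h3 : M 1 1 = Real.exp (-(s / 2)) := mul_right_cancel₀ hne (h2.trans hinv.symm)
    have h4 : M 0 0 = Real.exp (s / 2) := by
      rw [hs] at a0; linear_combination a0 + Real.exp (s / 2) * h2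
    clear a0 h2
    ext i j; fin_cases i <;> fin_cases j <;> simp [h3, h4, hb, hc]
  · right
    have h3 : M 1 1 = -Real.exp (-(s / 2)) := by
      apply mul_right_cancel₀ hne; rw [h2, neg_mul, hinv]
    have h4 : M 0 0 = -Real.exp (s / 2) := by
      rw [hs] at a0; linear_combination a0 + Real.exp (s / 2) * h2
    clear a0 h2
    ext i j; fin_cases i <;> fin_cases j <;> simp [h3, h4, hb, hc]

/-- A matrix conjugating two proper translations along the imaginary axis up to sign is itself
a translation along this axis, and the translations agree. -/
lemma eq_of_translation_mul {C : SL(2, ℝ)} {l l' : ℝ} (hl : 0 < l) (hl' : 0 < l')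
    (h : translation l * C = C * translation l' ∨ translation l * C = -(C * translation l')) :
    l = l' ∧ ∃ s, ∀ t, C • verticalGeodesic t = verticalGeodesic (t + s) := by
  obtain ⟨e, he, hC⟩ : ∃ e : ℝ, (e = 1 ∨ e = -1) ∧ ∀ i j,
      (translation l * C) i j = e * (C * translation l') i j := by
    rcases h with h | h
    · exact ⟨1, Or.inl rfl, fun i j => by rw [h, one_mul]⟩
    · exact ⟨-1, Or.inr rfl, fun i j => by rw [h]; simp⟩
  have h00 := hC 0 0
  have h01 := hC 0 1
  have h10 := hC 1 0
  simp only [Matrix.SpecialLinearGroup.coe_mul, Matrix.mul_apply, Fin.sum_univ_two,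
    translation_apply_zero_zero, translation_apply_zero_one, translation_apply_one_zero,
    translation_apply_one_one, zero_mul, mul_zero, add_zero, zero_add] at h00 h01 h10
  have x1 : 1 < Real.exp (l / 2) := by rw [Real.one_lt_exp_iff]; linarith
  have y1 : 1 < Real.exp (l' / 2) := by rw [Real.one_lt_exp_iff]; linarith
  have xi : Real.exp (-(l / 2)) * Real.exp (l / 2) = 1 := by rw [← Real.exp_add]; simp
  have yi : Real.exp (-(l' / 2)) * Real.exp (l' / 2) = 1 := by rw [← Real.exp_add]; simp
  set x := Real.exp (l / 2) with hx
  set y := Real.exp (l' / 2) with hy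
  have hxy : 1 < x * y := by nlinarith
  have e1 : e ≤ 1 := by rcases he with rfl | rfl <;> norm_num
  have ee : e * e = 1 := by rcases he with rfl | rfl <;> norm_num
  -- The commutation relation multiplies each off-diagonal entry of `C` by `x * y - e`, which is
  -- positive since `x * y > 1 ≥ e`.
  have q0 : C 0 1 = 0 := by
    have : C 0 1 * (x * y - e) = 0 := by linear_combination y * h01 + e * C 0 1 * yi
    rcases mul_eq_zero.mp this with h | h
    · exact h
    · linarith
  have r0 : C 1 0 = 0 := by
    have : C 1 0 * (x * y - e) = 0 := by
      linear_combination -e * x * h10 + e * C 1 0 * xi - C 1 0 * x * y * ee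
    rcases mul_eq_zero.mp this with h | h
    · exact h
    · linarith
  have hd := det_real C
  rw [q0, zero_mul, sub_zero] at hd
  have p0 : C 0 0 ≠ 0 := by intro h; rw [h] at hd; simp at hd
  have hxe : x = e * y := mul_right_cancel₀ p0 (by linear_combination h00)
  have he' : e = 1 := by
    rcases he with h | h
    · exact h
    · rw [h] at hxe; linarith
  rw [he', one_mul] at hxe
  refine ⟨by have := Real.exp_injective hxe; linarith, Real.log (C 0 0 ^ 2), fun t => ?_⟩
  rw [smul_verticalGeodesic_eq_iff, q0, r0, Real.exp_add, Real.exp_log (by positivity)]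
  constructor
  · simp
  · linear_combination - C 0 0 * Real.exp t * hd

lemma exists_realMatrix (g : Modular) :
    ∃ A : SL(2, ℤ), QuotientGroup.mk A = g ∧ ∀ z : ℍ, g • z = realMatrix A • z := by
  obtain ⟨A, rfl⟩ := exists_mk g
  exact ⟨A, rfl, fun z => by rw [mk_smul, realMatrix_smul]⟩

lemma IsGeodesicLine.smul {c : ℝ → ℍ} (hc : IsGeodesicLine c) (g : Modular) :
    IsGeodesicLine fun t => g • c t := by
  obtain ⟨A, hA⟩ := hc
  obtain ⟨G, -, hG⟩ := exists_realMatrix g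
  exact ⟨realMatrix G * A, fun t => by simp only [hG, hA, mul_smul]⟩

/-- An element of the modular group is conjugate to a translation if it translates a line. -/
lemma exists_realMatrix_eq_translation {A : SL(2, ℝ)} {g : Modular} {s : ℝ}
    (h : ∀ t, g • (A • verticalGeodesic t) = A • verticalGeodesic (t + s)) :
    ∃ G : SL(2, ℤ), QuotientGroup.mk G = g ∧ realMatrix G * A = A * translation s := by
  obtain ⟨G, hG, hs⟩ := exists_realMatrix g
  have := eq_or_eq_neg_translation (M := A⁻¹ * realMatrix G * A) (s := s) fun t => by
    rw [mul_smul, mul_smul, ← hs, h, inv_smul_smul]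
  rw [mul_assoc, inv_mul_eq_iff_eq_mul, inv_mul_eq_iff_eq_mul] at this
  rcases this with h | h
  · exact ⟨G, hG, h⟩
  · refine ⟨-G, by rw [mk_neg, hG], ?_⟩
    have : realMatrix (-G) = -realMatrix G := by
      ext i j
      simp [realMatrix_apply]
    rw [this, neg_mul, h, mul_neg, neg_neg]

/-- The axis and the translation length of a hyperbolic element are unique. -/
lemma IsGeodesicLine.eq_of_translate {c c' : ℝ → ℍ} (hc : IsGeodesicLine c)
    (hc' : IsGeodesicLine c') {g : Modular} {l l' : ℝ} (hl : 0 < l) (hl' : 0 < l')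
    (h : ∀ t, g • c t = c (t + l)) (h' : ∀ t, g • c' t = c' (t + l')) :
    l = l' ∧ ∃ s, ∀ t, c' t = c (t + s) := by
  obtain ⟨A, hA⟩ := hc
  obtain ⟨B, hB⟩ := hc'
  obtain ⟨G, hG, hGA⟩ := exists_realMatrix_eq_translation (A := A) (g := g) (s := l) fun t => by
    rw [← hA, h, hA]
  obtain ⟨H, hH, hHB⟩ := exists_realMatrix_eq_translation (A := B) (g := g) (s := l') fun t => by
    rw [← hB, h', hB]
  have hGH : realMatrix G = realMatrix H ∨ realMatrix G = -realMatrix H := by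
    rw [← hH, mk_eq_mk_iff] at hG
    rcases hG with rfl | rfl
    · exact Or.inl rfl
    · right; ext i j; simp [realMatrix_apply]
  have hG' : realMatrix G = A * translation l * A⁻¹ := by rw [← hGA]; group
  have hH' : realMatrix H = B * translation l' * B⁻¹ := by rw [← hHB]; group
  have key : translation l * (A⁻¹ * B) = A⁻¹ * B * translation l' ∨
      translation l * (A⁻¹ * B) = -(A⁻¹ * B * translation l') := by
    rw [hG', hH'] at hGH
    rcases hGH with h | h
    · left
      have := congrArg (fun x => A⁻¹ * x * B) h
      simpa [mul_assoc] using this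
    · right
      have := congrArg (fun x => A⁻¹ * x * B) h
      simpa [mul_assoc] using this
  obtain ⟨hll, s, hs⟩ := eq_of_translation_mul hl hl' key
  refine ⟨hll, s, fun t => ?_⟩
  rw [hB, hA, ← hs t, mul_smul, smul_inv_smul]

lemma IsGeodesicLine.eq_one_of_smul_eq {c : ℝ → ℍ} (hc : IsGeodesicLine c) {g : Modular}
    (h : ∀ t, g • c t = c t) : g = 1 := by
  obtain ⟨A, hA⟩ := hc
  obtain ⟨G, hG, hGA⟩ := exists_realMatrix_eq_translation (A := A) (g := g) (s := 0) fun t => by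
    rw [← hA, h, hA, add_zero]
  have h0 : translation 0 = 1 := by
    ext i j; fin_cases i <;> fin_cases j <;> simp
  rw [h0, mul_one, mul_eq_right] at hGA
  rw [← hG, mk_eq_one_iff]
  left
  ext i j
  have : (G i j : ℝ) = (1 : SL(2, ℝ)) i j := by rw [← realMatrix_apply, hGA]
  have h1 : ((1 : SL(2, ℤ)) i j : ℝ) = (1 : SL(2, ℝ)) i j := by
    rw [← realMatrix_apply, map_one]
  exact_mod_cast this.trans h1.symm

lemma IsGeodesicLine.eq_of_smul_eq {c : ℝ → ℍ} (hc : IsGeodesicLine c) {g h : Modular}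
    (hgh : ∀ t, g • c t = h • c t) : g = h := by
  rw [← inv_mul_eq_one]
  refine (hc.smul 1).eq_one_of_smul_eq fun t => ?_
  rw [one_smul, mul_smul, inv_smul_eq_iff, hgh]

/-- Translation lengths are bounded below. -/
lemma IsGeodesicLine.translation_length_eq_zero {c : ℝ → ℍ} (hc : IsGeodesicLine c) {g : Modular}
    {s : ℝ} (h : ∀ t, g • c t = c (t + s)) (hs : |s| < 1) : s = 0 := by
  obtain ⟨A, hA⟩ := hc
  obtain ⟨G, hG, hGA⟩ := exists_realMatrix_eq_translation (A := A) (g := g) (s := s) fun t => by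
    rw [← hA, h, hA]
  -- The trace is an integer equal to `2 cosh (s/2)`. For `|s| < 1` it lies in `[2, 3)`, hence
  -- equals `2`, and `s = 0`.
  have htr : ((G 0 0 + G 1 1 : ℤ) : ℝ) = Real.exp (s / 2) + Real.exp (-(s / 2)) := by
    have h1 : realMatrix G = A * translation s * A⁻¹ := by rw [← hGA]; group
    have h2 : Matrix.trace (realMatrix G : Matrix (Fin 2) (Fin 2) ℝ) =
        Matrix.trace (translation s : Matrix (Fin 2) (Fin 2) ℝ) := by
      rw [h1, Matrix.SpecialLinearGroup.coe_mul, Matrix.trace_mul_comm,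
        ← Matrix.SpecialLinearGroup.coe_mul, ← mul_assoc, inv_mul_cancel, one_mul]
    rw [Matrix.trace_fin_two, Matrix.trace_fin_two] at h2
    push_cast
    exact h2
  rw [abs_lt] at hs
  set u := Real.exp (s / 2) with hu
  have hui : Real.exp (-(s / 2)) * u = 1 := by rw [← Real.exp_add]; simp
  have h4 : Real.exp 1 < 4 := by have := Real.exp_one_lt_d9; linarith
  have half : ∀ x : ℝ, x < 1 / 2 → Real.exp x < 2 := by
    intro x hx
    have h5 : Real.exp x < Real.exp (1 / 2) := Real.exp_lt_exp.mpr hx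
    have h6 : Real.exp (1 / 2) ^ 2 = Real.exp 1 := by rw [← Real.exp_nat_mul]; norm_num
    nlinarith [Real.exp_pos (1 / 2)]
  have u2 : u < 2 := half _ (by linarith)
  have v2 : Real.exp (-(s / 2)) < 2 := half _ (by linarith)
  have u0 : 0 < u := Real.exp_pos _
  have v0 := Real.exp_pos (-(s / 2))
  set v := Real.exp (-(s / 2))
  have hlt : u + v < 3 := by nlinarith
  have hge : 2 ≤ u + v := by nlinarith [sq_nonneg (u - v)]
  have hn : G 0 0 + G 1 1 = 2 := by
    rw [← htr] at hlt hge
    have a1 : G 0 0 + G 1 1 < 3 := by exact_mod_cast hlt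
    have a2 : 2 ≤ G 0 0 + G 1 1 := by exact_mod_cast hge
    omega
  rw [hn] at htr
  push_cast at htr
  have : u = 1 := by nlinarith [sq_nonneg (u - 1)]
  rw [hu, Real.exp_eq_one_iff] at this
  linarith

lemma zpow_smul_line {c : ℝ → ℍ} {g : Modular} {s : ℝ} (h : ∀ t, g • c t = c (t + s)) (n : ℤ)
    (t : ℝ) : g ^ n • c t = c (t + n * s) := by
  have hinv : ∀ t, g⁻¹ • c t = c (t - s) := fun t => by
    rw [inv_smul_eq_iff, h]; simp
  induction n generalizing t with
  | zero => simp
  | succ n ih => rw [zpow_add_one, mul_smul, h, ih]; push_cast; ring_nf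
  | pred n ih => rw [zpow_sub_one, mul_smul, hinv, ih]; push_cast; ring_nf

/-- An element commuting with a hyperbolic element translates its axis. -/
lemma IsGeodesicLine.exists_translate_of_commute {c : ℝ → ℍ} (hc : IsGeodesicLine c)
    {g x : Modular} {l : ℝ} (hl : 0 < l) (h : ∀ t, g • c t = c (t + l)) (hx : x * g = g * x) :
    ∃ s, ∀ t, x • c t = c (t + s) :=
  (hc.eq_of_translate (hc.smul x) hl hl h fun t => by
    rw [← mul_smul, ← hx, mul_smul, h]).2

/-- The centralizer of a primitive hyperbolic element is generated by this element. -/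
lemma IsGeodesicLine.exists_eq_zpow {c : ℝ → ℍ} (hc : IsGeodesicLine c)
    {g x : Modular} {l : ℝ} (hl : 0 < l) (h : ∀ t, g • c t = c (t + l))
    (hg : IsPrimitiveElement g) (hx : x * g = g * x) : ∃ n : ℤ, x = g ^ n := by
  -- The translation lengths along `c` form a discrete, hence cyclic, subgroup of `ℝ`. An element
  -- `b` realizing a generator has `g` among its powers, and primitivity gives `g = b^±1`.
  let H : AddSubgroup ℝ :=
    { carrier := {s | ∃ b : Modular, ∀ t, b • c t = c (t + s)}
      zero_mem' := ⟨1, fun t => by simp⟩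
      add_mem' := by
        rintro s s' ⟨b, hb⟩ ⟨b', hb'⟩
        exact ⟨b * b', fun t => by rw [mul_smul, hb', hb]; ring_nf⟩
      neg_mem' := by
        rintro s ⟨b, hb⟩
        exact ⟨b⁻¹, fun t => by rw [inv_smul_eq_iff, hb]; simp⟩ }
  obtain ⟨a, ha⟩ : ∃ a, H = AddSubgroup.closure {a} := by
    refine AddSubgroup.cyclic_of_isolated_zero (a := 1) one_pos ?_
    rw [Set.disjoint_left]
    rintro s ⟨b, hb⟩ ⟨hs0, hs1⟩
    exact hs0.ne' (hc.translation_length_eq_zero hb (by rwa [abs_of_pos hs0]))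
  have hmem : ∀ s, (∃ b : Modular, ∀ t, b • c t = c (t + s)) → ∃ n : ℤ, s = n * a := by
    intro s hs
    have : s ∈ H := hs
    rw [ha, AddSubgroup.mem_closure_singleton] at this
    obtain ⟨n, hn⟩ := this
    exact ⟨n, by rw [← hn]; simp⟩
  obtain ⟨b, hb⟩ : ∃ b : Modular, ∀ t, b • c t = c (t + a) := by
    have : a ∈ H := by rw [ha]; exact AddSubgroup.mem_closure_singleton_self a
    exact this
  have hpow : ∀ (y : Modular) (s : ℝ), (∀ t, y • c t = c (t + s)) → ∃ n : ℤ, y = b ^ n := by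
    intro y s hy
    obtain ⟨n, rfl⟩ := hmem s ⟨y, hy⟩
    exact ⟨n, hc.eq_of_smul_eq fun t => by rw [hy, zpow_smul_line hb]⟩
  obtain ⟨k, hk⟩ := hpow g l h
  obtain ⟨s, hs⟩ := hc.exists_translate_of_commute hl h hx
  obtain ⟨m, hm⟩ := hpow x s hs
  rcases hg b k hk with rfl | rfl
  · exact ⟨m, by rw [hk, hm, zpow_one]⟩
  · exact ⟨-m, by rw [hk, hm, ← zpow_mul]; simp⟩

/-! ### Lines through the cone point of order two -/

lemma verticalGeodesic_zero : verticalGeodesic 0 = UpperHalfPlane.I := by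
  ext; rw [verticalGeodesic]; simp [Complex.ext_iff]

lemma iota_smul (z : ℍ) : iota • z = realMatrix ModularGroup.S • z := by
  rw [realMatrix_smul]; rfl

lemma iota_smul_verticalGeodesic (t : ℝ) :
    iota • verticalGeodesic t = verticalGeodesic (-t) := by
  rw [iota_smul, smul_verticalGeodesic_eq_iff]
  simp [realMatrix_apply, ModularGroup.coe_S, ← Real.exp_add]

lemma iota_smul_I : iota • UpperHalfPlane.I = UpperHalfPlane.I := by
  rw [← verticalGeodesic_zero, iota_smul_verticalGeodesic, neg_zero]

lemma eq_I_of_iota_smul {z : ℍ} (h : iota • z = z) : z = UpperHalfPlane.I := by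
  rw [iota_smul, smul_eq_iff] at h
  simp [realMatrix_apply, ModularGroup.coe_S, Complex.ext_iff] at h
  obtain ⟨h1, h2⟩ := h
  have him := z.im_pos
  have hre : z.re = 0 := by
    have : z.re * z.im = 0 := by linarith
    exact (mul_eq_zero.mp this).resolve_right him.ne'
  have : z.im = 1 := by rw [hre] at h1; nlinarith
  ext
  rw [Complex.ext_iff]
  simp [hre, this]

/-- The involution `ι` reverses the lines through its fixed point. -/
lemma IsGeodesicLine.iota_smul {c : ℝ → ℍ} (hc : IsGeodesicLine c) {t₀ : ℝ}
    (h : c t₀ = UpperHalfPlane.I) (t : ℝ) : iota • c (t₀ + t) = c (t₀ - t) := by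
  obtain ⟨A, hA⟩ := hc
  set B := A * translation t₀ with hB
  have hcB : ∀ t, c (t₀ + t) = B • verticalGeodesic t := fun t => by
    rw [hA, hB, mul_smul, translation_smul, add_comm]
  have h0 : B • verticalGeodesic 0 = verticalGeodesic 0 := by
    rw [← hcB, add_zero, h, verticalGeodesic_zero]
  obtain ⟨h1, h2⟩ := (smul_verticalGeodesic_eq_iff _ _ _).mp h0
  simp only [Real.exp_zero, mul_one] at h1 h2
  -- `B` fixes `i`, so it is a rotation matrix and commutes with `S`; the reversal of the imaginary
  -- axis is carried over to `c`.
  have hcomm : realMatrix ModularGroup.S * B = B * realMatrix ModularGroup.S := by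
    ext i j
    fin_cases i <;> fin_cases j <;>
      simp [Matrix.mul_apply, Fin.sum_univ_two, realMatrix_apply, ModularGroup.coe_S, h1, h2]
  rw [hcB, ModularOrbifold.iota_smul, ← mul_smul, hcomm, mul_smul, ← ModularOrbifold.iota_smul,
    iota_smul_verticalGeodesic, ← hcB, sub_eq_add_neg]

/-- The bottom row `(c, d)` of such a matrix satisfies `|cz + d| = 1`, which leaves finitely many
integer pairs, and together with `z` it determines the top row. -/
lemma finite_setOf_smul_eq (z : ℍ) : {A : SL(2, ℤ) | A • z = z}.Finite := by
  have him := z.im_pos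
  have key : ∀ A : SL(2, ℤ), A • z = z → (A 0 0 : ℝ) = 2 * A 1 0 * z.re + A 1 1 ∧
      (A 0 1 : ℝ) = - A 1 0 * (z.re ^ 2 + z.im ^ 2) ∧
      (A 1 0 * z.re + A 1 1 : ℝ) ^ 2 + (A 1 0 * z.im) ^ 2 = 1 := by
    intro A hA
    rw [← realMatrix_smul, smul_eq_iff, Complex.ext_iff] at hA
    simp [realMatrix_apply] at hA
    obtain ⟨h1, h2⟩ := hA
    have ha : (A 0 0 : ℝ) = 2 * A 1 0 * z.re + A 1 1 :=
      mul_right_cancel₀ him.ne' (by linear_combination h2)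
    have hb : (A 0 1 : ℝ) = - A 1 0 * (z.re ^ 2 + z.im ^ 2) := by
      rw [ha] at h1; linear_combination h1
    refine ⟨ha, hb, ?_⟩
    have hd := det_real (realMatrix A)
    simp only [realMatrix_apply] at hd
    rw [ha, hb] at hd
    linear_combination hd
  obtain ⟨C, hC⟩ := exists_nat_ge (1 / z.im)
  obtain ⟨D, hD⟩ := exists_nat_ge (C * |z.re| + 1)
  refine Set.Finite.of_finite_image (f := fun A : SL(2, ℤ) => (A 1 0, A 1 1)) ?_ ?_
  · refine ((Set.finite_Icc (-(C : ℤ)) C).prod (Set.finite_Icc (-(D : ℤ)) D)).subset ?_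
    rintro _ ⟨A, hA, rfl⟩
    obtain ⟨-, -, h⟩ := key A hA
    have h1 : |(A 1 0 : ℝ)| ≤ C := by
      have : |(A 1 0 : ℝ) * z.im| ≤ 1 := by
        rw [← sq_le_one_iff_abs_le_one]; nlinarith [sq_nonneg (A 1 0 * z.re + A 1 1 : ℝ)]
      rw [abs_mul, abs_of_pos him, ← le_div_iff₀ him] at this
      exact this.trans hC
    have h2 : |(A 1 1 : ℝ)| ≤ D := by
      have : |(A 1 0 * z.re + A 1 1 : ℝ)| ≤ 1 := by
        rw [← sq_le_one_iff_abs_le_one]; nlinarith [sq_nonneg (A 1 0 * z.im : ℝ)]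
      calc |(A 1 1 : ℝ)| = |(A 1 0 * z.re + A 1 1 : ℝ) - A 1 0 * z.re| := by ring_nf
        _ ≤ |(A 1 0 * z.re + A 1 1 : ℝ)| + |A 1 0 * z.re| := abs_sub _ _
        _ ≤ 1 + C * |z.re| := by rw [abs_mul]; gcongr
        _ ≤ D := by linarith
    rw [abs_le] at h1 h2
    simp only [Set.mem_prod, Set.mem_Icc]
    exact_mod_cast And.intro h1 h2
  · intro A hA B hB hAB
    obtain ⟨a1, a2, -⟩ := key A hA
    obtain ⟨b1, b2, -⟩ := key B hB
    obtain ⟨hc, hd⟩ := Prod.ext_iff.mp hAB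
    simp only at hc hd
    rw [hc, hd, ← b1] at a1
    rw [hc, ← b2] at a2
    ext i j
    fin_cases i <;> fin_cases j
    exacts [by exact_mod_cast a1, by exact_mod_cast a2, hc, hd]

/-- Stabilizers are finite. -/
lemma finite_stabilizer (z : ℍ) : Finite (MulAction.stabilizer Modular z) := by
  refine Set.Finite.to_subtype (s := (MulAction.stabilizer Modular z : Set Modular)) ?_
  refine ((finite_setOf_smul_eq z).image (QuotientGroup.mk : SL(2, ℤ) → Modular)).subset ?_
  intro g hg
  obtain ⟨A, rfl⟩ := exists_mk g
  exact ⟨A, hg, rfl⟩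

/-- A cone point of even order lies in the orbit of `i`. -/
lemma exists_eq_smul_I {z : ℍ} (h : Even (Nat.card (MulAction.stabilizer Modular z))) :
    ∃ g : Modular, z = g • UpperHalfPlane.I := by
  have := finite_stabilizer z
  have : Fact (Nat.Prime 2) := ⟨Nat.prime_two⟩
  obtain ⟨⟨k, hk⟩, hk2⟩ := exists_prime_orderOf_dvd_card' (G := MulAction.stabilizer Modular z) 2
    (even_iff_two_dvd.mp h)
  rw [Subgroup.orderOf_mk, orderOf_eq_prime_iff, sq] at hk2
  obtain ⟨g, rfl⟩ := exists_eq_conj_iota hk2.1 hk2.2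
  refine ⟨g, ?_⟩
  rw [← inv_smul_eq_iff]
  apply eq_I_of_iota_smul
  rw [MulAction.mem_stabilizer_iff] at hk
  conv_rhs => rw [← hk]
  simp [mul_smul]

lemma even_card_stabilizer {z : ℍ} (h : iota • z = z) :
    Even (Nat.card (MulAction.stabilizer Modular z)) := by
  have h2 : orderOf iota = 2 := by
    have : Fact (Nat.Prime 2) := ⟨Nat.prime_two⟩
    rw [orderOf_eq_prime_iff, sq]
    exact ⟨iota_mul_self, iota_ne_one⟩
  have hmem : iota ∈ MulAction.stabilizer Modular z := h
  have h3 := orderOf_dvd_natCard (⟨iota, hmem⟩ : MulAction.stabilizer Modular z)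
  rw [Subgroup.orderOf_mk] at h3
  exact even_iff_two_dvd.mpr (h2.symm.dvd.trans h3)

/-- A symmetric matrix of determinant one is a translation along a line through `i`. -/
lemma exists_rotation {G : SL(2, ℝ)} (hs : G 1 0 = G 0 1) (h0 : 0 < G 0 0) (hb : G 0 1 ≠ 0) :
    ∃ (R : SL(2, ℝ)) (l : ℝ), 0 < l ∧ R 0 0 = R 1 1 ∧ R 0 1 = - R 1 0 ∧
      G * R = R * translation l := by
  have hd := det_real G
  rw [hs] at hd
  set a := G 0 0
  set b := G 0 1
  set d := G 1 1
  have hb2 : 0 < b ^ 2 := by positivity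
  have hd0 : 0 < d := by
    by_contra! h
    nlinarith
  have ht : 4 < (a + d) ^ 2 := by nlinarith [sq_nonneg (a - d)]
  set r := √((a + d) ^ 2 - 4) with hr
  have hr2 : r ^ 2 = (a + d) ^ 2 - 4 := Real.sq_sqrt (by linarith)
  have hr0 : 0 < r := Real.sqrt_pos.mpr (by linarith)
  -- `x > 1` is the larger eigenvalue and `(b, x - a)` an eigenvector. Normalized, it is the first
  -- column of the rotation `R`, and the translation length is `2 log x`.
  set x := (a + d + r) / 2 with hx
  have hx1 : 1 < x := by nlinarith
  have hxx : x ^ 2 - (a + d) * x + 1 = 0 := by rw [hx]; linear_combination hr2 / 4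
  have hx0 : 0 < x := by linarith
  have hn0 : 0 < b ^ 2 + (x - a) ^ 2 := by positivity
  set n := √(b ^ 2 + (x - a) ^ 2) with hn
  have hn2 : n ^ 2 = b ^ 2 + (x - a) ^ 2 := Real.sq_sqrt hn0.le
  have hnp : 0 < n := Real.sqrt_pos.mpr hn0
  have e1 : Real.exp (2 * Real.log x / 2) = x := by
    rw [mul_div_cancel_left₀ _ two_ne_zero, Real.exp_log hx0]
  have e2 : Real.exp (-(2 * Real.log x / 2)) = a + d - x := by
    rw [Real.exp_neg, e1]
    apply inv_eq_of_mul_eq_one_right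
    linear_combination -hxx
  have hdet : !![b / n, -((x - a) / n); (x - a) / n, b / n].det = 1 := by
    rw [Matrix.det_fin_two_of]
    field_simp
    linear_combination -hn2
  obtain ⟨R, r00, r01, r10, r11⟩ : ∃ R : SL(2, ℝ), R 0 0 = b / n ∧ R 0 1 = -((x - a) / n) ∧
      R 1 0 = (x - a) / n ∧ R 1 1 = b / n := ⟨⟨_, hdet⟩, rfl, rfl, rfl, rfl⟩
  refine ⟨R, 2 * Real.log x, by have := Real.log_pos hx1; linarith, by rw [r00, r11],
    by rw [r01, r10], ?_⟩
  ext i j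
  rw [Matrix.SpecialLinearGroup.coe_mul, Matrix.SpecialLinearGroup.coe_mul, Matrix.mul_apply,
    Matrix.mul_apply, Fin.sum_univ_two, Fin.sum_univ_two]
  fin_cases i <;> fin_cases j <;>
    simp only [translation_apply_zero_zero, translation_apply_zero_one, translation_apply_one_zero,
      translation_apply_one_one, e1, e2, Fin.zero_eta, Fin.mk_one, hs, r00, r01, r10, r11] <;>
    field_simp
  · ring
  · linear_combination -hd - hxx
  · linear_combination -hd - hxx
  · ring

/-- Since `S M⁻¹ S = -Mᵀ`, the matrix `N` is `M Mᵀ`. It is symmetric, so a rotation about `i`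
diagonalizes it and its axis passes through `i`. -/
lemma exists_line_reciprocalElement {w : List Bool} (hw : w ≠ []) :
    ∃ (c : ℝ → ℍ) (l : ℝ), IsGeodesicLine c ∧ 0 < l ∧ c 0 = UpperHalfPlane.I ∧
      ∀ t, reciprocalElement w • c t = c (t + l) := by
  set M := posMatrix w with hM
  set N : SL(2, ℤ) := -(M * ModularGroup.S * M⁻¹ * ModularGroup.S) with hN
  have hmk : QuotientGroup.mk N = reciprocalElement w := by
    rw [hN, mk_neg, reciprocalElement_eq, ← mk_posMatrix]; rfl
  have hd : M 0 0 * M 1 1 - M 0 1 * M 1 0 = 1 := posMatrix_det w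
  have n00 : N 0 0 = M 0 0 ^ 2 + M 0 1 ^ 2 := by
    rw [hN]
    simp [Matrix.mul_apply, Fin.sum_univ_two, ModularGroup.coe_S,
      Matrix.adjugate_fin_two]
    ring
  have n01 : N 0 1 = M 0 0 * M 1 0 + M 0 1 * M 1 1 := by
    rw [hN]
    simp [Matrix.mul_apply, Fin.sum_univ_two, ModularGroup.coe_S,
      Matrix.adjugate_fin_two]
    ring
  have n10 : N 1 0 = M 0 0 * M 1 0 + M 0 1 * M 1 1 := by
    rw [hN]
    simp [Matrix.mul_apply, Fin.sum_univ_two, ModularGroup.coe_S,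
      Matrix.adjugate_fin_two]
    ring
  have n11 : N 1 1 = M 1 0 ^ 2 + M 1 1 ^ 2 := by
    rw [hN]
    simp [Matrix.mul_apply, Fin.sum_univ_two, ModularGroup.coe_S,
      Matrix.adjugate_fin_two]
    ring
  have hdN : N 0 0 * N 1 1 - N 0 1 * N 1 0 = 1 := by
    have := N.det_coe
    rwa [Matrix.det_fin_two] at this
  have hpos : 0 < N 0 0 := by
    have h1 : 0 ≤ N 0 0 := by rw [n00]; positivity
    have h2 : 0 ≤ N 1 1 := by rw [n11]; positivity
    rcases h1.lt_or_eq with h | h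
    · exact h
    · rw [← h, n01, n10] at hdN
      nlinarith [sq_nonneg (M 0 0 * M 1 0 + M 0 1 * M 1 1)]
  have hne : N 0 1 ≠ 0 := by
    intro h
    rw [h, zero_mul, sub_zero] at hdN
    have h0 : N 0 0 = 1 := by
      rcases Int.eq_one_or_neg_one_of_mul_eq_one hdN with h | h
      · exact h
      · omega
    rw [h0, one_mul] at hdN
    apply reciprocalElement_ne_one hw
    rw [← hmk, mk_eq_one_iff]
    left
    have h10 : N 1 0 = 0 := by rw [n10, ← n01, h]
    clear_value N
    ext i j; fin_cases i <;> fin_cases j <;> simp [h, h0, hdN, h10]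
  obtain ⟨R, l, hl, hR1, hR2, hR⟩ := exists_rotation (G := realMatrix N)
    (by simp only [realMatrix_apply]; rw [n10, n01])
    (by rw [realMatrix_apply]; exact_mod_cast hpos) (by rw [realMatrix_apply]; exact_mod_cast hne)
  refine ⟨fun t => R • verticalGeodesic t, l, ⟨R, fun _ => rfl⟩, hl, ?_, fun t => ?_⟩
  · simp only [← verticalGeodesic_zero]
    rw [smul_verticalGeodesic_eq_iff]
    simp [hR1, hR2]
  · simp only
    rw [← hmk, mk_smul, ← realMatrix_smul, ← mul_smul, hR, mul_smul, translation_smul]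


/-! ### Closed geodesics and conjugacy classes -/

lemma IsPrimitiveElement.of_isConj {g h : Modular} (hg : IsPrimitiveElement g)
    (hc : IsConj g h) : IsPrimitiveElement h := by
  obtain ⟨c, rfl⟩ := isConj_iff.mp hc
  intro b k hk
  refine hg (c⁻¹ * b * c) k ?_
  have := conj_zpow (i := k) (a := c⁻¹) (b := b)
  rw [inv_inv] at this
  rw [this, ← hk]; group

lemma IsPrimitiveElement.ne_one {g : Modular} (hg : IsPrimitiveElement g) : g ≠ 1 := by
  rintro rfl
  have := hg 1 0 (by simp)
  omega

lemma IsPrimitiveElement.ne_iota {g : Modular} (hg : IsPrimitiveElement g) : g ≠ iota := by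
  rintro rfl
  have := hg iota 3 (by rw [show (3 : ℤ) = 1 + 1 + 1 by norm_num, zpow_add, zpow_add]; simp)
  omega

lemma isometryEquiv_real_apply (e : ℝ ≃ᵢ ℝ) :
    (∀ t, e t = e 0 + t) ∨ ∀ t, e t = e 0 - t := by
  set L := (e.trans (IsometryEquiv.subRight (e 0))).toRealLinearIsometryEquivOfMapZero (by simp)
    with hL
  have hLt : ∀ t, e t = e 0 + t * L 1 := by
    intro t
    have h1 : L t = t * L 1 := by
      have := L.map_smul t 1
      simpa using this
    have h2 : L t = e t - e 0 := rfl
    rw [← h1, h2]; ring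
  have h1 : |L 1| = 1 := by
    exact (L.norm_map 1).trans norm_one
  rcases eq_or_eq_neg_of_abs_eq h1 with h | h
  · left; intro t; rw [hLt t, h]; ring
  · right; intro t; rw [hLt t, h]; ring

lemma lift_eq_of_equiv {x y : ParamClosedGeodesic} (hxy : x ≈ y) :
    ∃ h : Modular, y.lift = h * x.lift * h⁻¹ ∨ y.lift = h * x.lift⁻¹ * h⁻¹ := by
  obtain ⟨hp, h, e, he⟩ := hxy
  refine ⟨h, ?_⟩
  rcases isometryEquiv_real_apply e with h1 | h1
  · left
    refine y.isGeodesicLine.eq_of_smul_eq fun t => ?_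
    rw [y.lift_smul, he, he, mul_smul, mul_smul, inv_smul_smul, x.lift_smul, h1, h1 t, hp]
    ring_nf
  · right
    refine y.isGeodesicLine.eq_of_smul_eq fun t => ?_
    rw [y.lift_smul, he, he, mul_smul, mul_smul, inv_smul_smul]
    congr 1
    rw [eq_inv_smul_iff, x.lift_smul, h1, h1 t, hp]
    ring_nf

/-- Axis and period are determined by the lift, so conjugate lifts suffice to identify closed
geodesics. -/
lemma equiv_of_lift_eq {x y : ParamClosedGeodesic} {h : Modular}
    (hxy : y.lift = h * x.lift * h⁻¹) : x ≈ y := by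
  obtain ⟨hp, s, hs⟩ := (x.isGeodesicLine.smul h).eq_of_translate y.isGeodesicLine (g := y.lift)
    x.period_pos y.period_pos
    (fun t => by rw [hxy, mul_smul, mul_smul, inv_smul_smul, x.lift_smul]) y.lift_smul
  exact ⟨hp, h, IsometryEquiv.addRight s, hs⟩

/-! ### Reciprocal geodesics and words -/

lemma exists_paramClosedGeodesic (w : List Bool) : ∃ x : ParamClosedGeodesic,
    w ≠ [] → x.lift = reciprocalElement w ∧ x.line 0 = UpperHalfPlane.I := by
  by_cases hw : w = []
  -- The empty word gives the identity, which is no lift; an arbitrary geodesic serves as default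
  -- value.
  · obtain ⟨c, l, hc, hl, -, h⟩ := exists_line_reciprocalElement (w := [true]) (by simp)
    exact ⟨⟨c, hc, l, hl, _, h⟩, fun h => absurd hw h⟩
  · obtain ⟨c, l, hc, hl, h0, h⟩ := exists_line_reciprocalElement hw
    exact ⟨⟨c, hc, l, hl, _, h⟩, fun _ => ⟨rfl, h0⟩⟩

/-- A parametrized closed geodesic through `i` with lift `reciprocalElement w` if `w` is not
empty. -/
noncomputable def reciprocalGeodesic (w : List Bool) : ParamClosedGeodesic :=
  (exists_paramClosedGeodesic w).choose

lemma reciprocalGeodesic_lift {w : List Bool} (hw : w ≠ []) :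
    (reciprocalGeodesic w).lift = reciprocalElement w :=
  ((exists_paramClosedGeodesic w).choose_spec hw).1

lemma reciprocalGeodesic_line_zero {w : List Bool} (hw : w ≠ []) :
    (reciprocalGeodesic w).line 0 = UpperHalfPlane.I :=
  ((exists_paramClosedGeodesic w).choose_spec hw).2

/-- The nonempty words of signs with primitive reciprocal element. -/
def IsPrimitiveWord (w : List Bool) : Prop := w ≠ [] ∧ IsPrimitiveElement (reciprocalElement w)

/-- If `f` translates a line through `i` then `f ι` is an involution. -/
lemma IsGeodesicLine.mul_iota_mul_self {c : ℝ → ℍ} (hc : IsGeodesicLine c) {t₀ s : ℝ}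
    (h0 : c t₀ = UpperHalfPlane.I) {f : Modular} (h : ∀ t, f • c t = c (t + s)) :
    f * iota * (f * iota) = 1 := by
  refine hc.eq_one_of_smul_eq fun t => ?_
  obtain ⟨u, rfl⟩ : ∃ u, t = t₀ + u := ⟨t - t₀, by ring⟩
  rw [mul_smul, mul_smul, mul_smul, hc.iota_smul h0, h,
    show t₀ - u + s = t₀ + (s - u) by ring, hc.iota_smul h0, h]
  ring_nf

lemma primitiveReciprocalGeodesics_eq (L : ℝ) : primitiveReciprocalGeodesics L =
    (fun w => (⟦reciprocalGeodesic w⟧ : ClosedGeodesic)) ''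
      {w | IsPrimitiveWord w ∧ 4 * (w.length : ℝ) ≤ L} := by
  ext γ
  constructor
  · rintro ⟨x, rfl, hx, ⟨t₀, ht⟩, hL⟩
    obtain ⟨g, hg⟩ := exists_eq_smul_I ht
    set f := g⁻¹ * x.lift * g with hf
    have hc : IsConj x.lift f := isConj_iff.mpr ⟨g⁻¹, by rw [inv_inv]⟩
    have hfp := hx.of_isConj hc
    have hline := x.isGeodesicLine.smul g⁻¹
    have hj := hline.mul_iota_mul_self (t₀ := t₀) (s := x.period) (f := f)
      (by simp only [hg, inv_smul_smul]) fun t => by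
        rw [hf, mul_smul, mul_smul, smul_inv_smul, x.lift_smul]
    obtain ⟨w, hw, hfw⟩ := exists_reciprocalElement hj
      (fun h => hfp.ne_iota (by rw [mul_eq_one_iff_eq_inv, iota_inv] at h; exact h))
      (fun h => hfp.ne_one (by simpa using h))
    rw [mul_assoc, iota_mul_self, mul_one] at hfw
    have hfw' : IsConj f (reciprocalElement w) := by
      rcases hfw with h | h
      · rw [h]
      · rw [h]
        exact isConj_iff.mpr ⟨iota, by simp [mul_assoc]⟩
    have hxw := hc.trans hfw'
    refine ⟨w, ⟨⟨hw, hx.of_isConj hxw⟩, ?_⟩, ?_⟩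
    · rw [classLength_eq_of_isConj hxw, classLength_reciprocalElement] at hL
      exact_mod_cast hL
    · obtain ⟨h, hh⟩ := isConj_iff.mp hxw.symm
      exact Quotient.sound (equiv_of_lift_eq (h := h) (by rw [reciprocalGeodesic_lift hw, hh]))
  · rintro ⟨w, ⟨⟨hw, hp⟩, hL⟩, rfl⟩
    refine ⟨reciprocalGeodesic w, rfl, ?_, ⟨0, even_card_stabilizer ?_⟩, ?_⟩
    · rw [ParamClosedGeodesic.IsPrimitive, reciprocalGeodesic_lift hw]; exact hp
    · rw [reciprocalGeodesic_line_zero hw, iota_smul_I]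
    · rw [reciprocalGeodesic_lift hw, classLength_reciprocalElement]
      exact_mod_cast hL

lemma iota_mul_zpow_reciprocalElement (w : List Bool) (n : ℤ) :
    iota * reciprocalElement w ^ n = reciprocalElement w ^ (-n) * iota := by
  have h := conj_zpow (i := n) (a := iota) (b := reciprocalElement w)
  rw [iota_inv, iota_mul_reciprocalElement_mul_iota, inv_zpow'] at h
  rw [h]; simp [mul_assoc]

/-- Both reciprocal elements are inverted by `ι`, so `c⁻¹ιcι` commutes with `g` and is a power `g^n`
by primitivity. The involution `g^n ι` is conjugate by a power of `g` to `ι` if `n` is even, and to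
`gι = pιp⁻¹` if `n` is odd, where `p = posWord w`. Correcting `c` accordingly yields an element of
the centralizer of `ι`, and the parity decides between `w` and `antiReverse w`. -/
lemma eq_or_eq_antiReverse_of_isConj {v w : List Bool} (hw : IsPrimitiveWord w)
    (h : IsConj (reciprocalElement w) (reciprocalElement v)) : v = w ∨ v = antiReverse w := by
  obtain ⟨c, hc⟩ := isConj_iff.mp h
  obtain ⟨γ, l, hγ, hl, -, hg⟩ := exists_line_reciprocalElement hw.1
  set g := reciprocalElement w with hgdef
  have hinv : iota * g = g⁻¹ * iota := by
    have := iota_mul_zpow_reciprocalElement w 1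
    simpa using this
  have hv : iota * (c * g * c⁻¹) * iota = c * g⁻¹ * c⁻¹ := by
    rw [hc, iota_mul_reciprocalElement_mul_iota, ← hc]; group
  have hk : c⁻¹ * iota * c * g⁻¹ = g * (c⁻¹ * iota * c) := by
    have h1 := congrArg (fun x => c⁻¹ * iota * x * c) hv
    simp only [mul_assoc, iota_mul_iota_mul, inv_mul_cancel_left, inv_mul_cancel, mul_one] at h1
    simp only [mul_assoc]
    exact h1.symm
  have hcomm : (c⁻¹ * iota * c * iota) * g = g * (c⁻¹ * iota * c * iota) := by
    rw [mul_assoc _ iota g, hinv, ← mul_assoc, hk, mul_assoc]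
  obtain ⟨n, hn⟩ := hγ.exists_eq_zpow hl hg hw.2 hcomm
  have hn' : c⁻¹ * iota * c = g ^ n * iota := by rw [← hn]; simp [mul_assoc]
  have conj_of : ∀ (d : Modular) (u : List Bool), iota * d = d * iota →
      reciprocalElement v = d * reciprocalElement u * d⁻¹ → v = u := by
    intro d u hd hu
    apply eq_of_reciprocalElement_eq
    rcases eq_one_or_iota_of_commute hd.symm with rfl | rfl
    · left; simpa using hu
    · right; simpa using hu
  rcases Int.even_or_odd' n with ⟨m, rfl | rfl⟩
  · left
    refine conj_of (c * g ^ m) w ?_ ?_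
    · have h1 : iota * c = c * (g ^ (2 * m) * iota) := by rw [← hn']; group
      rw [← mul_assoc, h1, mul_assoc, mul_assoc, hgdef, iota_mul_zpow_reciprocalElement, mul_assoc,
        ← mul_assoc (_ ^ (2 * m)), ← zpow_add]
      ring_nf
    · rw [← hc, ← hgdef]; group
  · right
    refine conj_of (c * g ^ m * posWord w) (antiReverse w) ?_ ?_
    · have h1 : iota * c = c * (g ^ (2 * m + 1) * iota) := by rw [← hn']; group
      have h2 : g * iota * posWord w = posWord w * iota := by
        rw [hgdef, reciprocalElement_eq]; simp [mul_assoc]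
      have h3 : g ^ (2 * m + 1) * iota * g ^ m = g ^ m * (g * iota) := by
        rw [mul_assoc, hgdef, iota_mul_zpow_reciprocalElement, ← mul_assoc, ← zpow_add,
          ← mul_assoc, ← zpow_add_one]
        ring_nf
      calc iota * (c * g ^ m * posWord w) = (iota * c) * g ^ m * posWord w := by group
        _ = c * (g ^ (2 * m + 1) * iota * g ^ m) * posWord w := by rw [h1]; group
        _ = c * g ^ m * (g * iota * posWord w) := by rw [h3]; group
        _ = c * g ^ m * posWord w * iota := by rw [h2]; group
    · rw [reciprocalElement_antiReverse, ← hc, ← hgdef]; group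

lemma isConj_reciprocalElement_antiReverse (w : List Bool) :
    IsConj (reciprocalElement w) (reciprocalElement (antiReverse w)) :=
  isConj_iff.mpr ⟨(posWord w)⁻¹, by rw [reciprocalElement_antiReverse, inv_inv]⟩

lemma IsPrimitiveWord.antiReverse {w : List Bool} (hw : IsPrimitiveWord w) :
    IsPrimitiveWord (antiReverse w) :=
  ⟨by simpa using hw.1, hw.2.of_isConj (isConj_reciprocalElement_antiReverse w)⟩

/-- Otherwise the reciprocal element would be the square of `posWord w`. -/
lemma IsPrimitiveWord.antiReverse_ne {w : List Bool} (hw : IsPrimitiveWord w) :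
    ModularOrbifold.antiReverse w ≠ w := by
  intro h
  have := hw.2 (posWord w) 2 (by
    rw [reciprocalElement, h, posWord_append, zpow_two])
  omega

lemma mk_reciprocalGeodesic_eq_iff {v w : List Bool} (hv : v ≠ []) (hw : IsPrimitiveWord w) :
    (⟦reciprocalGeodesic v⟧ : ClosedGeodesic) = ⟦reciprocalGeodesic w⟧ ↔
      v = w ∨ v = antiReverse w := by
  constructor
  · intro h
    apply eq_or_eq_antiReverse_of_isConj hw
    obtain ⟨h, h1 | h1⟩ := lift_eq_of_equiv (Quotient.exact h.symm)
    · rw [reciprocalGeodesic_lift hv, reciprocalGeodesic_lift hw.1] at h1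
      exact isConj_iff.mpr ⟨h, h1.symm⟩
    -- Reversing the orientation identifies nothing new: `ι` already conjugates a reciprocal element
    -- to its inverse.
    · rw [reciprocalGeodesic_lift hv, reciprocalGeodesic_lift hw.1,
        ← iota_mul_reciprocalElement_mul_iota] at h1
      exact isConj_iff.mpr ⟨h * iota, by rw [h1]; simp [mul_assoc]⟩
  · rintro (rfl | rfl)
    · rfl
    · obtain ⟨h, hh⟩ := isConj_iff.mp (isConj_reciprocalElement_antiReverse w).symm
      exact Quotient.sound (equiv_of_lift_eq (h := h)
        (by rw [reciprocalGeodesic_lift hv, reciprocalGeodesic_lift hw.1, hh]))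

lemma reciprocalElement_mul_self_ne_one {w : List Bool} (hw : w ≠ []) :
    reciprocalElement w * reciprocalElement w ≠ 1 := by
  rw [reciprocalElement, ← posWord_append, Ne, posWord_eq_one_iff]
  simp [hw]

lemma iota_conj_pow (g : Modular) (n : ℕ) : (iota * g * iota) ^ n = iota * g ^ n * iota := by
  have := conj_pow (i := n) (a := iota) (b := g)
  rwa [iota_inv] at this

/-- A reciprocal element which is not primitive is a power of a shorter reciprocal element up to
conjugation by `ι`. -/
lemma exists_eq_pow_of_not_isPrimitiveWord {w : List Bool} (hw : w ≠ [])
    (h : ¬ IsPrimitiveWord w) : ∃ (v : List Bool) (m : ℕ), v ≠ [] ∧ 2 ≤ m ∧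
      w.length = m * v.length ∧ (reciprocalElement w = reciprocalElement v ^ m ∨
        reciprocalElement w = iota * reciprocalElement v ^ m * iota) := by
  obtain ⟨b, m, hm, hb⟩ : ∃ (b : Modular) (m : ℕ), 2 ≤ m ∧ reciprocalElement w = b ^ m := by
    simp only [IsPrimitiveWord, hw, ne_eq, not_false_eq_true, true_and, IsPrimitiveElement,
      not_forall, not_or] at h
    obtain ⟨b, k, hk, h1, h2⟩ := h
    have h0 : k ≠ 0 := by
      rintro rfl
      exact reciprocalElement_ne_one hw (by simpa using hk)
    rcases Int.natAbs_eq k with h3 | h3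
    · exact ⟨b, k.natAbs, by omega, by rw [hk, ← zpow_natCast, ← h3]⟩
    · refine ⟨b⁻¹, k.natAbs, by omega, ?_⟩
      rw [hk, inv_pow, ← zpow_natCast, ← zpow_neg, ← h3]
  obtain ⟨c, l, hc, hl, h0, hg⟩ := exists_line_reciprocalElement hw
  -- The root `b` translates the same line through `i`, so `bι` is again an involution and `b` is
  -- itself reciprocal up to conjugation by `ι`.
  obtain ⟨s, hs⟩ := hc.exists_translate_of_commute hl hg (x := b) (by
    rw [hb, ← pow_succ', pow_succ])
  obtain ⟨v, hv, hbv⟩ := exists_reciprocalElement (hc.mul_iota_mul_self h0 hs) (by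
    intro h1
    rw [mul_eq_one_iff_eq_inv, iota_inv] at h1
    apply reciprocalElement_mul_self_ne_one hw
    rw [hb, h1, ← (Commute.refl iota).mul_pow, iota_mul_self, one_pow]) (by
    intro h1
    apply reciprocalElement_ne_one hw
    rw [hb, mul_eq_right.mp h1, one_pow])
  rw [mul_assoc, iota_mul_self, mul_one] at hbv
  have hwv : reciprocalElement w = reciprocalElement v ^ m ∨
      reciprocalElement w = iota * reciprocalElement v ^ m * iota := by
    rcases hbv with h | h
    · exact Or.inl (by rw [hb, h])
    · exact Or.inr (by rw [hb, h, iota_conj_pow])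
  refine ⟨v, m, hv, hm, ?_, hwv⟩
  have hconj : IsConj (reciprocalElement w) (reciprocalElement v ^ m) := by
    rcases hwv with h | h
    · rw [h]
    · rw [h]
      exact isConj_iff.mpr ⟨iota, by simp [mul_assoc]⟩
  have hl := classLength_eq_of_isConj hconj
  rw [classLength_reciprocalElement, reciprocalElement, ← posWord_replicate,
    classLength_posWord] at hl
  simp at hl
  nlinarith

/-! ### Counting -/

/-- The nonempty words of signs of length at most `K`. -/
def wordsUpTo (K : ℕ) : Finset (List Bool) :=
  (Finset.Icc 1 K).biUnion fun k =>
    (Finset.univ : Finset (Fin k → Bool)).map ⟨List.ofFn, List.ofFn_injective⟩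

lemma mem_wordsUpTo {K : ℕ} {w : List Bool} : w ∈ wordsUpTo K ↔ w ≠ [] ∧ w.length ≤ K := by
  simp only [wordsUpTo, Finset.mem_biUnion, Finset.mem_Icc, Finset.mem_map, Finset.mem_univ,
    true_and, Function.Embedding.coeFn_mk]
  constructor
  · rintro ⟨k, ⟨h1, h2⟩, f, rfl⟩
    refine ⟨?_, by simpa using h2⟩
    rw [← List.length_pos_iff, List.length_ofFn]; exact h1
  · rintro ⟨h1, h2⟩
    exact ⟨w.length, ⟨List.length_pos_iff.mpr h1, h2⟩, w.get, List.ofFn_get w⟩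

lemma card_wordsUpTo (K : ℕ) : (wordsUpTo K).card + 2 = 2 ^ (K + 1) := by
  rw [wordsUpTo, Finset.card_biUnion]
  · simp only [Finset.card_map, Finset.card_univ, Fintype.card_fun, Fintype.card_bool,
      Fintype.card_fin]
    induction K with
    | zero => simp
    | succ K ih => rw [Finset.sum_Icc_succ_top (by omega), pow_succ]; omega
  · intro i _ j _ hij
    change Disjoint _ _
    rw [Finset.disjoint_left]
    rintro w hi hj
    simp only [Finset.mem_map, Finset.mem_univ, true_and, Function.Embedding.coeFn_mk] at hi hj
    obtain ⟨f, rfl⟩ := hi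
    obtain ⟨f', h⟩ := hj
    have := congrArg List.length h
    simp only [List.length_ofFn] at this
    exact hij this.symm

open Classical in
/-- The primitive words of length at most `K`. -/
noncomputable def primitiveWords (K : ℕ) : Finset (List Bool) :=
  (wordsUpTo K).filter IsPrimitiveWord

open Classical in
lemma card_filter_not_isPrimitiveWord_le (K : ℕ) :
    ((wordsUpTo K).filter fun w => ¬ IsPrimitiveWord w).card ≤ 2 ^ (K / 2 + 1) * (K + 1) := by
  -- A non-primitive word is encoded by its root and exponent `(v, m)`: `m ≥ 2` gives `|v| ≤ K/2`,
  -- and `|v| ≥ 1` gives `m ≤ K`.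
  have hex : ∀ w : List Bool, ∃ q : List Bool × ℕ, w ∈ (wordsUpTo K).filter
      (fun w => ¬ IsPrimitiveWord w) → q ∈ wordsUpTo (K / 2) ×ˢ Finset.range (K + 1) ∧
      (reciprocalElement w = reciprocalElement q.1 ^ q.2 ∨
        reciprocalElement w = iota * reciprocalElement q.1 ^ q.2 * iota) := by
    intro w
    by_cases hw : w ∈ (wordsUpTo K).filter (fun w => ¬ IsPrimitiveWord w)
    · rw [Finset.mem_filter, mem_wordsUpTo] at hw
      obtain ⟨v, m, hv, hm, hl, h⟩ := exists_eq_pow_of_not_isPrimitiveWord hw.1.1 hw.2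
      refine ⟨(v, m), fun _ => ⟨?_, h⟩⟩
      have hv1 : 1 ≤ v.length := List.length_pos_iff.mpr hv
      have hlK := hw.1.2
      rw [Finset.mem_product, mem_wordsUpTo, Finset.mem_range]
      refine ⟨⟨hv, ?_⟩, ?_⟩
      · rw [Nat.le_div_iff_mul_le two_pos]
        simp only
        nlinarith
      · simp only
        nlinarith
    · exact ⟨([], 0), fun h => absurd h hw⟩
  choose q hq using hex
  calc _ ≤ (wordsUpTo (K / 2) ×ˢ Finset.range (K + 1)).card := by
        refine Finset.card_le_card_of_injOn q (fun w hw => (hq w hw).1) ?_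
        intro v hv w hw hvw
        have h1 := (hq v hv).2
        have h2 := (hq w hw).2
        rw [hvw] at h1
        apply eq_of_reciprocalElement_eq
        rcases h1 with h1 | h1 <;> rcases h2 with h2 | h2 <;> rw [h1, h2] <;> simp [mul_assoc]
    _ ≤ _ := by
        rw [Finset.card_product, Finset.card_range]
        have := card_wordsUpTo (K / 2)
        exact Nat.mul_le_mul_right _ (by omega)

lemma card_primitiveWords_le (K : ℕ) : (primitiveWords K).card ≤ 2 ^ (K + 1) := by
  classical
  have := card_wordsUpTo K
  have := Finset.card_filter_le (wordsUpTo K) IsPrimitiveWord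
  rw [primitiveWords]
  omega

lemma le_card_primitiveWords (K : ℕ) :
    2 ^ (K + 1) ≤ (primitiveWords K).card + 2 + 2 ^ (K / 2 + 1) * (K + 1) := by
  classical
  have h1 := card_wordsUpTo K
  have h2 := Finset.card_filter_add_card_filter_not (s := wordsUpTo K) IsPrimitiveWord
  have h3 := card_filter_not_isPrimitiveWord_le K
  rw [primitiveWords]
  omega

lemma primitiveReciprocalGeodesics_eq_image (t : ℝ) : primitiveReciprocalGeodesics (2 * t) =
    (fun w => (⟦reciprocalGeodesic w⟧ : ClosedGeodesic)) '' primitiveWords ⌊t / 2⌋₊ := by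
  classical
  rw [primitiveReciprocalGeodesics_eq]
  congr 1
  ext w
  simp only [primitiveWords, Set.mem_ofPred_eq, Finset.coe_filter, mem_wordsUpTo]
  constructor
  · rintro ⟨h1, h2⟩
    refine ⟨⟨h1.1, ?_⟩, h1⟩
    -- As the word has nonzero length, no sign condition on `t` is needed.
    rw [Nat.le_floor_iff' (List.length_pos_iff.mpr h1.1).ne']
    linarith
  · rintro ⟨⟨-, h2⟩, h1⟩
    rw [Nat.le_floor_iff' (List.length_pos_iff.mpr h1.1).ne'] at h2
    exact ⟨h1, by linarith⟩

lemma two_mul_ncard (t : ℝ) :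
    2 * (primitiveReciprocalGeodesics (2 * t)).ncard = (primitiveWords ⌊t / 2⌋₊).card := by
  classical
  set K := ⌊t / 2⌋₊
  have hmem : ∀ w, w ∈ primitiveWords K ↔ w.length ≤ K ∧ IsPrimitiveWord w := by
    intro w
    rw [primitiveWords, Finset.mem_filter, mem_wordsUpTo]
    exact ⟨fun h => ⟨h.1.2, h.2⟩, fun h => ⟨⟨h.2.1, h.1⟩, h.2⟩⟩
  rw [primitiveReciprocalGeodesics_eq_image, ← Finset.coe_image, Set.ncard_coe_finset,
    Finset.card_eq_sum_card_image (fun w => (⟦reciprocalGeodesic w⟧ : ClosedGeodesic))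
      (primitiveWords K), Finset.sum_const_nat (m := 2), mul_comm]
  intro γ hγ
  obtain ⟨w, hw, rfl⟩ := Finset.mem_image.mp hγ
  have hwp := ((hmem w).mp hw).2
  have : (primitiveWords K).filter (fun v =>
      (⟦reciprocalGeodesic v⟧ : ClosedGeodesic) = ⟦reciprocalGeodesic w⟧) =
      {w, antiReverse w} := by
    ext v
    rw [Finset.mem_filter, Finset.mem_insert, Finset.mem_singleton]
    constructor
    · rintro ⟨h1, h2⟩
      exact (mk_reciprocalGeodesic_eq_iff ((hmem v).mp h1).2.1 hwp).mp h2
    · intro h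
      have hv : v ∈ primitiveWords K := by
        rcases h with rfl | rfl
        · exact hw
        · rw [hmem, length_antiReverse]
          exact ⟨((hmem w).mp hw).1, hwp.antiReverse⟩
      exact ⟨hv, (mk_reciprocalGeodesic_eq_iff ((hmem v).mp hv).2.1 hwp).mpr h⟩
  rw [this]
  exact Finset.card_pair hwp.antiReverse_ne.symm

/-- This is the lower bound for `N(t) / 2^K`. The last term comes from the non-primitive words: with
`m = K - K/2`, `2^(K/2) (K + 1) / 2^K ≤ (2m + 1) / 2^m`. -/
lemma tendsto_error : Tendsto (fun K : ℕ => 1 - (1 / 2 : ℝ) ^ K -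
    (2 * (K - K / 2 : ℕ) + 1) * (1 / 2 : ℝ) ^ (K - K / 2)) atTop (𝓝 1) := by
  have h1 : Tendsto (fun m : ℕ => (1 / 2 : ℝ) ^ m) atTop (𝓝 0) :=
    tendsto_pow_atTop_nhds_zero_of_lt_one (by norm_num) (by norm_num)
  have h2 : Tendsto (fun m : ℕ => (2 * (m : ℝ) + 1) * (1 / 2 : ℝ) ^ m) atTop (𝓝 0) := by
    have := ((tendsto_self_mul_const_pow_of_lt_one (r := (1 / 2 : ℝ)) (by norm_num)
      (by norm_num)).const_mul 2).add h1
    simp only [mul_zero, add_zero] at this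
    refine this.congr fun m => ?_
    ring
  have h3 : Tendsto (fun K : ℕ => K - K / 2) atTop atTop := by
    refine tendsto_atTop_mono (f := fun K : ℕ => K / 2) (fun K => ?_)
      (Nat.tendsto_div_const_atTop two_ne_zero)
    omega
  have := ((tendsto_const_nhds (x := (1 : ℝ))).sub h1).sub (h2.comp h3)
  simpa using this

lemma ncard_div_bounds {t : ℝ} (ht : 0 ≤ t) :
    1 - (1 / 2 : ℝ) ^ ⌊t / 2⌋₊ - (2 * (⌊t / 2⌋₊ - ⌊t / 2⌋₊ / 2 : ℕ) + 1) *
        (1 / 2 : ℝ) ^ (⌊t / 2⌋₊ - ⌊t / 2⌋₊ / 2) ≤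
      ((primitiveReciprocalGeodesics (2 * t)).ncard : ℝ) / (2 : ℝ) ^ ⌊t / 2⌋ ∧
    ((primitiveReciprocalGeodesics (2 * t)).ncard : ℝ) / (2 : ℝ) ^ ⌊t / 2⌋ ≤ 1 := by
  -- Integer and natural floor agree here because `t ≥ 0`.
  have hfl : (2 : ℝ) ^ ⌊t / 2⌋ = 2 ^ ⌊t / 2⌋₊ := by
    rw [← zpow_natCast, Int.natCast_floor_eq_floor (by positivity)]
  rw [hfl]
  have hN := two_mul_ncard t
  set K := ⌊t / 2⌋₊
  set N := (primitiveReciprocalGeodesics (2 * t)).ncard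
  have hu := card_primitiveWords_le K
  have hl := le_card_primitiveWords K
  rw [← hN] at hu hl
  set m := K - K / 2 with hm
  have hKm : K / 2 + m = K := by omega
  have hpos : (0 : ℝ) < 2 ^ K := by positivity
  constructor
  · rw [le_div_iff₀ hpos]
    have hl' : (2 : ℝ) ^ (K + 1) ≤ 2 * N + 2 + 2 ^ (K / 2 + 1) * (K + 1) := by exact_mod_cast hl
    have e1 : (1 / 2 : ℝ) ^ K * 2 ^ K = 1 := by rw [← mul_pow]; norm_num
    have e2 : (1 / 2 : ℝ) ^ m * 2 ^ K = 2 ^ (K / 2) := by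
      conv_lhs => rw [← hKm, pow_add, mul_left_comm, ← mul_pow]
      norm_num
    have e3 : (K : ℝ) ≤ 2 * m := by
      have : K ≤ 2 * m := by omega
      exact_mod_cast this
    have e4 : (2 : ℝ) ^ (K / 2) * (K + 1) ≤ 2 ^ (K / 2) * (2 * m + 1) := by gcongr
    rw [pow_succ, pow_succ] at hl'
    calc (1 - (1 / 2 : ℝ) ^ K - (2 * (m : ℝ) + 1) * (1 / 2) ^ m) * 2 ^ K
        = 2 ^ K - (1 / 2 : ℝ) ^ K * 2 ^ K - (2 * (m : ℝ) + 1) * ((1 / 2) ^ m * 2 ^ K) := by ring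
      _ = 2 ^ K - 1 - 2 ^ (K / 2) * (2 * (m : ℝ) + 1) := by rw [e1, e2]; ring
      _ ≤ N := by linarith
  · rw [div_le_one hpos]
    have hu' : (2 * N : ℝ) ≤ 2 ^ (K + 1) := by exact_mod_cast hu
    rw [pow_succ] at hu'
    linarith

end ModularOrbifold


theorem corollary1p4 :
    (∀ t : ℝ, (ModularOrbifold.primitiveReciprocalGeodesics (2 * t)).Finite) ∧
      Tendsto
        (fun t : ℝ =>
          ((ModularOrbifold.primitiveReciprocalGeodesics (2 * t)).ncard : ℝ) /
            (2 : ℝ) ^ ⌊t / 2⌋)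
        atTop (𝓝 1) := by
  refine ⟨fun t => ?_, ?_⟩
  · rw [ModularOrbifold.primitiveReciprocalGeodesics_eq_image]
    exact (Finset.finite_toSet _).image _
  · have hK : Tendsto (fun t : ℝ => ⌊t / 2⌋₊) atTop atTop :=
      tendsto_nat_floor_atTop.comp (tendsto_id.atTop_div_const two_pos)
    refine tendsto_of_tendsto_of_tendsto_of_le_of_le' (ModularOrbifold.tendsto_error.comp hK)
      tendsto_const_nhds ?_ ?_
    · filter_upwards [eventually_ge_atTop 0] with t ht
      exact (ModularOrbifold.ncard_div_bounds ht).1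
    · filter_upwards [eventually_ge_atTop 0] with t ht
      exact (ModularOrbifold.ncard_div_bounds ht).2
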